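/- **Notation.** Let $d\ge 1$. For functions on $\mathbb R^d$ put $\langle f,h\rangle=\int_{\mathbb R^d} f(x)\overline{h(x)}\,dx$, $T_tf(x)=f(x-t)$, $M_\omega f(x)=e^{2\pi i\langle\omega,x\rangle}f(x)$ and $\tau(t,\omega)=M_\omega T_t$. Let $$S_0(\mathbb R^d)=\Big\{g\in L^2(\mathbb R^d): (t,\omega)\mapsto\langle g,\tau(t,\omega)g\rangle \text{ belongs to } L^1(\mathbb R^{2d})\Big\}.$$ With $Q=[0,1)^d$, let $W(L^p,\ell^q)$ be the space of measurable $f:\mathbb R^d\to\mathbb C$ with $\|f\|_{W(L^p,\ell^q)}=\big(\sum_{k\in\mathbb Z^d}\|f\cdot T_k\chi_Q\|_p^q\big)^{1/q}<\infty$ (supremum over $k$ if $q=\infty$). For $g,\gamma\in S_0(\mathbb R^d)$ with $\langle\gamma,g\rangle\neq0$, $a,b>0$ and $f\in W(L^p,\ell^q)$ let $$S_{a,b;g,\gamma}f=\frac{(ab)^d}{\langle\gamma,g\rangle}\sum_{n,m\in\mathbb Z^d}\langle f,\tau(na,mb)g\rangle\,\tau(na,mb)\gamma ,$$ where the series is understood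 weakly: $u=S_{a,b;g,\gamma}f$ means that for every $h\in S_0(\mathbb R^d)$ the series $\frac{(ab)^d}{\langle\gamma,g\rangle}\sum_{n,m}\langle f,\tau(na,mb)g\rangle\langle\tau(na,mb)\gamma,h\rangle$ converges unconditionally to $\langle u,h\rangle$. **Theorem** (Wexler–Raz biorthogonality). Let $g,\gamma\in S_0(\mathbb R^d)$ with $\langle\gamma,g\rangle\ne0$, and let $1\le p<\infty$, $1\le q\le\infty$. Then the following are equivalent: (a) for every $f\in W(L^p,\ell^q)$, the functions $S_{a,b;g,\gamma}f$ and $S_{a,b;\gamma,g}f$ exist in $W(L^p,\ell^q)$ for all $a,b>0$, and $\|S_{a,b;g,\gamma}f-f\|_{W(L^p,\ell^q)}\to0$ and $\|S_{a,b;\gamma,g}f-f\|_{W(L^p,\ell^q)}\to0$ as $(a,b)\to(0,0)$ with $a,b>0$; (b) for all $l,n\in\mathbb Z^d$, $$\lim_{(a,b)\to(0,0),\ a,b>0}\ \frac{1}{\langle\gamma,g\rangle}\,\big\langle\gamma,M_{l/a}T_{n/b}\,g\big\rangle=\delta_{l0}\,\delta_{n0}.$$ -/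

import Mathlib

open MeasureTheory Filter Topology
open scoped ENNReal ComplexConjugate

noncomputable section

namespace GaborAmalgam

/-- The pairing `⟨f, g⟩ = ∫ f(x) conj(g(x)) dx` over `ℝ^d` with Lebesgue measure. -/
def pairing {d : ℕ} (f g : EuclideanSpace ℝ (Fin d) → ℂ) : ℂ :=
  ∫ x, f x * conj (g x)

/-- Translation `T_t f(x) = f(x - t)`. -/
def translate {d : ℕ} (t : EuclideanSpace ℝ (Fin d)) (f : EuclideanSpace ℝ (Fin d) → ℂ) :
    EuclideanSpace ℝ (Fin d) → ℂ :=
  fun x => f (x - t)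

/-- Modulation `M_ω f(x) = exp(2πi⟨ω, x⟩) f(x)`. -/
def modulate {d : ℕ} (ω : EuclideanSpace ℝ (Fin d)) (f : EuclideanSpace ℝ (Fin d) → ℂ) :
    EuclideanSpace ℝ (Fin d) → ℂ :=
  fun x => Complex.exp (2 * Real.pi * Complex.I * ((inner ℝ ω x : ℝ) : ℂ)) * f x

/-- The time-frequency shift `τ(t, ω) g (x) = g(x - t) exp(2πi⟨x, ω⟩)`, that is `M_ω T_t g`. -/
def timeFreqShift {d : ℕ} (t ω : EuclideanSpace ℝ (Fin d))
    (g : EuclideanSpace ℝ (Fin d) → ℂ) : EuclideanSpace ℝ (Fin d) → ℂ :=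
  modulate ω (translate t g)

/-- The windowed Fourier transform `(F_g f)(t, ω) = ⟨f, τ(t, ω) g⟩` as a function on `ℝ^{2d}`. -/
def windowedFourier {d : ℕ} (g f : EuclideanSpace ℝ (Fin d) → ℂ) :
    EuclideanSpace ℝ (Fin d) × EuclideanSpace ℝ (Fin d) → ℂ :=
  fun z => pairing f (timeFreqShift z.1 z.2 g)

/-- Membership in Feichtinger's algebra `S_0(ℝ^d) = {g ∈ L² : F_g g ∈ L¹(ℝ^{2d})}`. -/
def MemS0 {d : ℕ} (g : EuclideanSpace ℝ (Fin d) → ℂ) : Prop :=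
  MemLp g 2 volume ∧ Integrable (windowedFourier g g) volume

/-- The shifted unit cube `k + [0,1)^d`. -/
def cube {d : ℕ} (k : Fin d → ℤ) : Set (EuclideanSpace ℝ (Fin d)) :=
  {x | ∀ i, (k i : ℝ) ≤ x i ∧ x i < (k i : ℝ) + 1}

/-- The norm of the Wiener amalgam space `W(L^p, ℓ^q)`, with values in `[0, ∞]`: the `ℓ^q` norm over
`k ∈ ℤ^d` of the `L^p` norms of `f · T_k χ_{[0,1)^d}`. -/
def amalgamNorm {d : ℕ} (p q : ℝ≥0∞) (f : EuclideanSpace ℝ (Fin d) → ℂ) : ℝ≥0∞ :=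
  if q = ∞ then ⨆ k : Fin d → ℤ, eLpNorm ((cube k).indicator f) p volume
  else (∑' k : Fin d → ℤ, eLpNorm ((cube k).indicator f) p volume ^ q.toReal) ^ (1 / q.toReal)

/-- Membership in the Wiener amalgam space `W(L^p, ℓ^q)`. -/
def MemAmalgam {d : ℕ} (p q : ℝ≥0∞) (f : EuclideanSpace ℝ (Fin d) → ℂ) : Prop :=
  AEStronglyMeasurable f volume ∧ amalgamNorm p q f < ∞

/-- The lattice point `c • n ∈ ℝ^d`, for `c ∈ ℝ` and `n ∈ ℤ^d`. -/
def latticePoint {d : ℕ} (c : ℝ) (n : Fin d → ℤ) : EuclideanSpace ℝ (Fin d) :=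
  WithLp.toLp 2 fun i => c * (n i : ℝ)

/-- `IsGaborSum a b g γ f u` says that `u` is the sum `S_{a,b;g,γ} f` of the Gabor series
`(ab)^d ⟨γ, g⟩⁻¹ ∑_{n,m ∈ ℤ^d} ⟨f, τ(na, mb) g⟩ τ(na, mb) γ`. The series is summed unconditionally
in the weak sense, against all `h ∈ S_0(ℝ^d)`; this determines `u` up to null sets among the
functions in amalgam spaces. (For general `f` the series need not converge in norm, for instance
if `f ∈ L¹` or `f ∈ W(L^p, ℓ^∞)`.) -/
def IsGaborSum {d : ℕ} (a b : ℝ) (g γ f u : EuclideanSpace ℝ (Fin d) → ℂ) : Prop :=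
  ∀ h : EuclideanSpace ℝ (Fin d) → ℂ, MemS0 h →
    HasSum (fun nm : (Fin d → ℤ) × (Fin d → ℤ) =>
      ((a * b : ℝ) : ℂ) ^ d * (pairing γ g)⁻¹ *
        (pairing f (timeFreqShift (latticePoint a nm.1) (latticePoint b nm.2) g) *
          pairing (timeFreqShift (latticePoint a nm.1) (latticePoint b nm.2) γ) h))
      (pairing u h)

/-- `S_{a,b;g,γ} f → f` on `W(L^p, ℓ^q)` as `(a, b) → (0, 0)` with `a, b > 0`: for every
`f ∈ W(L^p, ℓ^q)`, all the functions `S_{a,b;g,γ} f` exist in `W(L^p, ℓ^q)`, and they converge to `f`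
in norm. -/
def GaborConverges {d : ℕ} (p q : ℝ≥0∞) (g γ : EuclideanSpace ℝ (Fin d) → ℂ) : Prop :=
  ∀ f : EuclideanSpace ℝ (Fin d) → ℂ, MemAmalgam p q f →
    ∃ S : ℝ → ℝ → EuclideanSpace ℝ (Fin d) → ℂ,
      (∀ a b : ℝ, 0 < a → 0 < b → MemAmalgam p q (S a b) ∧ IsGaborSum a b g γ f (S a b)) ∧
      Tendsto (fun ab : ℝ × ℝ => amalgamNorm p q (S ab.1 ab.2 - f))
        (𝓝[>] (0 : ℝ) ×ˢ 𝓝[>] (0 : ℝ)) (𝓝 0)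

end GaborAmalgam

end

/-! For windows in $S_0$ conditions (a) and (b) both hold, so the equivalence is proved by
establishing each side separately.

The main tool is the Janssen representation. It rewrites $S_{a,b;g,\gamma}f$ as
$\langle\gamma,g\rangle^{-1}\sum_{\lambda}\langle\gamma,\tau(\lambda)g\rangle\,\tau(\lambda)f$,
where $\lambda$ runs over the adjoint lattice $b^{-1}\mathbb Z^d\times a^{-1}\mathbb Z^d$. The term
$\lambda=0$ is $f$ itself. Time-frequency shifts are uniformly bounded on $W(L^p,\ell^q)$
(`amalgamNorm_timeFreqShift_le`), so $\|S_{a,b;g,\gamma}f-f\|\le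
C\|f\|\sum_{\lambda\ne0}|\langle\gamma,\tau(\lambda)g\rangle|$. As $(a,b)\to0$ the nonzero points of
the adjoint lattice leave every bounded set. Both (a) and (b) thus follow once this sum tends to $0$
(`LocallyDominated.tendsto_tsum_tfPoint`).

Integrability alone does not control samples on a lattice. It is replaced by `LocallyDominated`: a
pointwise bound by averages of an integrable function over balls of any prescribed radius. At
separated points the balls are disjoint, so sums of samples are bounded by one integral. The
Gaussian has this property. The orthogonality relations bound other windowed Fourier transforms by
convolutions with integrable functions, and convolution preserves it (`MemS0.locallyDominated`).

The Janssen identity is proved pointwise a.e. for $h\in S_0$ by Poisson summation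
(`MemS0.janssen_ae_eq`). It passes to $f$ in the amalgam space by duality, which is exactly the weak
sense in which the Gabor series is summed (`isGaborSum_janssenOp`). -/

noncomputable section

namespace GaborAmalgam

open scoped FourierTransform SchwartzMap

/-! ### Fourier inversion almost everywhere. -/

section Fourier

variable {V : Type*} [NormedAddCommGroup V] [InnerProductSpace ℝ V]
    [MeasurableSpace V] [BorelSpace V] [FiniteDimensional ℝ V]

theorem integral_fourier_mul_eq {f u : V → ℂ} (hf : Integrable f) (hu : Integrable u) :
    ∫ x, 𝓕 f x * u x = ∫ x, f x * 𝓕 u x := by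
  have := VectorFourier.integral_fourierIntegral_smul_eq_flip (μ := (volume : Measure V))
      (ν := (volume : Measure V)) (L := innerₗ V)
      Real.continuous_fourierChar (by exact continuous_inner) hf hu
  rw [flip_innerₗ] at this
  exact this

theorem integral_fourierInv_mul_eq {f u : V → ℂ} (hf : Integrable f) (hu : Integrable u) :
    ∫ x, 𝓕⁻ f x * u x = ∫ x, f x * 𝓕⁻ u x := by
  have := VectorFourier.integral_fourierIntegral_smul_eq_flip (μ := (volume : Measure V))
      (ν := (volume : Measure V)) (L := -innerₗ V)
      Real.continuous_fourierChar (by exact continuous_inner.neg) hf hu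
  have h : (-innerₗ V).flip = -innerₗ V := by ext x y; simp [real_inner_comm]
  rw [h] at this
  exact this

theorem continuous_fourierInv {f : V → ℂ} (hf : Integrable f) : Continuous (𝓕⁻ f) :=
  VectorFourier.fourierIntegral_continuous Real.continuous_fourierChar
      (by exact continuous_inner.neg) hf

/-- Fourier inversion, almost everywhere, for integrable functions with integrable transform. -/
theorem fourierInv_fourier_ae_eq {f : V → ℂ}
    (hf : Integrable f) (h'f : Integrable (𝓕 f)) : 𝓕⁻ (𝓕 f) =ᵐ[volume] f := by
  -- Both sides are compared as distributions: the transforms are moved onto a smooth compactly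
  -- supported test function, where Schwartz inversion applies.
  refine ae_eq_of_integral_contDiff_smul_eq (continuous_fourierInv h'f).locallyIntegrable
    hf.locallyIntegrable ?_
  intro u hu hsupp
  have hs' : HasCompactSupport (fun x => (u x : ℂ)) :=
    hsupp.comp_left (g := fun r : ℝ => (r : ℂ)) (by simp)
  let U : 𝓢(V, ℂ) := hs'.toSchwartzMap (Complex.ofRealCLM.contDiff.comp hu)
  have hU : ∀ x, U x = (u x : ℂ) := fun x => rfl
  have h1 : ∫ x, 𝓕⁻ (𝓕 f) x * U x = ∫ x, 𝓕 f x * (𝓕⁻ U) x := by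
    rw [SchwartzMap.fourierInv_coe]
    exact integral_fourierInv_mul_eq h'f U.integrable
  have h2 : ∫ x, 𝓕 f x * (𝓕⁻ U) x = ∫ x, f x * (𝓕 (𝓕⁻ U)) x := by
    rw [SchwartzMap.fourier_coe]
    exact integral_fourier_mul_eq hf (𝓕⁻ U).integrable
  rw [FourierTransform.fourier_fourierInv_eq] at h2
  calc ∫ x, u x • 𝓕⁻ (𝓕 f) x = ∫ x, 𝓕⁻ (𝓕 f) x * U x := by
        congr with x; rw [hU, Complex.real_smul, mul_comm]
    _ = ∫ x, f x * U x := h1.trans h2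
    _ = _ := by congr with x; rw [hU, Complex.real_smul, mul_comm]

end Fourier

/-! ### Fourier series on the torus and Poisson summation over the integer lattice. -/

section Torus

set_option linter.unusedSectionVars false

open UnitAddTorus

/-- Lebesgue measure on the circle of length one. -/
local instance : MeasureSpace UnitAddCircle := ⟨AddCircle.haarAddCircle⟩

local instance : Measure.IsAddHaarMeasure (volume : Measure UnitAddCircle) :=
  inferInstanceAs (Measure.IsAddHaarMeasure AddCircle.haarAddCircle)

local instance : IsProbabilityMeasure (volume : Measure UnitAddCircle) :=
  inferInstanceAs (IsProbabilityMeasure AddCircle.haarAddCircle)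

variable {ι : Type*} [Fintype ι]

/-- An integrable function on the torus is determined by its Fourier coefficients. -/
theorem ae_eq_zero_of_mFourierCoeff_eq_zero {J : UnitAddTorus ι → ℂ} (hJ : Integrable J)
    (h0 : ∀ n, ∫ t, mFourier n t * J t = 0) : J =ᵐ[volume] 0 := by
  have hint : ∀ u : C(UnitAddTorus ι, ℂ), Integrable (fun t => u t * J t) := fun u =>
    hJ.bdd_mul u.continuous.aestronglyMeasurable (c := ‖u‖)
      (Eventually.of_forall fun t => u.norm_coe_le_norm t)
  -- The functional $u\mapsto\int uJ$ is continuous for the sup norm and kills all characters, whose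
  -- span is dense. Indicators of closed sets are then reached as dominated limits of continuous
  -- functions.
  have key : ∀ u : C(UnitAddTorus ι, ℂ), ∫ t, u t * J t = 0 := by
    let L : C(UnitAddTorus ι, ℂ) →ₗ[ℂ] ℂ :=
      { toFun := fun u => ∫ t, u t * J t
        map_add' := fun u v => by
          rw [← integral_add (hint u) (hint v)]; simp [add_mul]
        map_smul' := fun c u => by
          simp only [ContinuousMap.smul_apply, smul_eq_mul, RingHom.id_apply]
          rw [← integral_const_mul]; simp [mul_assoc] }
    have hL : Continuous L := by
      refine (L.mkContinuous (∫ t, ‖J t‖) fun u => ?_).continuous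
      calc ‖∫ t, u t * J t‖ ≤ ∫ t, ‖u t * J t‖ := norm_integral_le_integral_norm _
        _ ≤ ∫ t, ‖u‖ * ‖J t‖ := by
          refine integral_mono (hint u).norm (hJ.norm.const_mul _) fun t => ?_
          simp only [norm_mul]
          gcongr
          exact u.norm_coe_le_norm t
        _ = _ := by rw [integral_const_mul, mul_comm]
    intro u
    have hu : u ∈ (Submodule.span ℂ (Set.range (mFourier (d := ι)))).topologicalClosure := by
      rw [span_mFourier_closure_eq_top]; trivial
    have hcl : (Submodule.span ℂ (Set.range (mFourier (d := ι)))).topologicalClosure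
        ≤ LinearMap.ker L := by
      refine Submodule.topologicalClosure_minimal _ ?_ (isClosed_singleton.preimage hL)
      rw [Submodule.span_le]
      rintro _ ⟨n, rfl⟩
      exact h0 n
    exact hcl hu
  refine ae_eq_zero_of_forall_setIntegral_isClosed_eq_zero hJ fun F hF => ?_
  have hlim : Tendsto (fun n : ℕ => ∫ t, ((hF.apprSeq n t : ℝ) : ℂ) * J t) atTop
      (𝓝 (∫ t, F.indicator J t)) := by
    refine tendsto_integral_of_dominated_convergence (fun t => ‖J t‖) ?_ hJ.norm ?_ ?_
    · intro n
      refine AEStronglyMeasurable.mul (Continuous.aestronglyMeasurable ?_) hJ.1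
      exact Complex.continuous_ofReal.comp (NNReal.continuous_coe.comp (hF.apprSeq n).continuous)
    · intro n
      filter_upwards with t
      have h1 : ((hF.apprSeq n t : NNReal) : ℝ) ≤ 1 := by
        exact_mod_cast HasOuterApproxClosed.apprSeq_apply_le_one hF n t
      have h2 : ‖(((hF.apprSeq n t : NNReal) : ℝ) : ℂ)‖ ≤ 1 := by
        rw [Complex.norm_real, Real.norm_of_nonneg (NNReal.coe_nonneg _)]; exact h1
      calc _ = ‖(((hF.apprSeq n t : NNReal) : ℝ) : ℂ)‖ * ‖J t‖ := norm_mul _ _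
        _ ≤ 1 * ‖J t‖ := by gcongr
        _ = _ := one_mul _
    · filter_upwards with t
      have := tendsto_pi_nhds.1 (HasOuterApproxClosed.tendsto_apprSeq hF) t
      have h3 : Tendsto (fun n => (((hF.apprSeq n t : NNReal) : ℝ) : ℂ)) atTop
          (𝓝 (((F.indicator (fun _ => (1 : NNReal)) t : NNReal) : ℝ) : ℂ)) :=
        (Complex.continuous_ofReal.comp NNReal.continuous_coe).continuousAt.tendsto.comp this
      convert h3.mul_const (J t) using 2
      by_cases ht : t ∈ F <;> simp [ht]
  rw [integral_indicator hF.measurableSet] at hlim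
  refine tendsto_nhds_unique hlim ?_
  have : ∀ n, ∫ t, ((hF.apprSeq n t : ℝ) : ℂ) * J t = 0 := fun n =>
    key ⟨fun t => ((hF.apprSeq n t : ℝ) : ℂ),
      Complex.continuous_ofReal.comp (NNReal.continuous_coe.comp (hF.apprSeq n).continuous)⟩
  simp [this]

/-- The half-open unit box with lower corner `k`. -/
def unitBox (k : ι → ℤ) : Set (ι → ℝ) := {x | ∀ i, x i ∈ Set.Ioc (k i : ℝ) (k i + 1)}

/-- An integer vector as a real vector. -/
def intVec (k : ι → ℤ) : ι → ℝ := fun i => (k i : ℝ)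

/-- The character `y ↦ exp (2πi ⟨m, y⟩)` of `ℝ^ι`. -/
def intChar (m : ι → ℤ) (y : ι → ℝ) : ℂ := mFourier m (fun i => (y i : UnitAddCircle))

theorem measurableSet_unitBox (k : ι → ℤ) : MeasurableSet (unitBox k) :=
  MeasurableSet.univ_pi' fun _ => measurableSet_Ioc

theorem mem_unitBox_iff {k : ι → ℤ} {x : ι → ℝ} : x ∈ unitBox k ↔ ∀ i, ⌈x i⌉ = k i + 1 := by
  refine forall_congr' fun i => ?_
  rw [Set.mem_Ioc, Int.ceil_eq_iff]
  push_cast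
  constructor <;> rintro ⟨h1, h2⟩ <;> constructor <;> linarith

theorem iUnion_unitBox : ⋃ k : ι → ℤ, unitBox k = Set.univ := by
  refine Set.eq_univ_of_forall fun x => Set.mem_iUnion.2 ⟨fun i => ⌈x i⌉ - 1, ?_⟩
  rw [mem_unitBox_iff]; simp

theorem pairwise_disjoint_unitBox : Pairwise (Function.onFun Disjoint (unitBox (ι := ι))) := by
  intro k l hkl
  rw [Function.onFun, Set.disjoint_left]
  intro x hk hl
  rw [mem_unitBox_iff] at hk hl
  exact hkl (funext fun i => by have := hk i; have := hl i; omega)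

theorem preimage_add_unitBox (k : ι → ℤ) :
    (fun y : ι → ℝ => y + intVec k) ⁻¹' unitBox k = unitBox 0 := by
  ext y
  simp only [unitBox, intVec, Set.mem_preimage, Set.mem_ofPred_eq, Pi.add_apply, Set.mem_Ioc,
    Pi.zero_apply, Int.cast_zero]
  refine forall_congr' fun i => ?_
  constructor <;> rintro ⟨h1, h2⟩ <;> constructor <;> linarith

theorem measurePreserving_add_intVec (k : ι → ℤ) :
    MeasurePreserving (fun y : ι → ℝ => y + intVec k) (volume.restrict (unitBox 0))
      (volume.restrict (unitBox k)) := by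
  have := (measurePreserving_add_right (volume : Measure (ι → ℝ)) (intVec k)).restrict_preimage
    (measurableSet_unitBox k)
  rwa [preimage_add_unitBox] at this

theorem setIntegral_unitBox (k : ι → ℤ) (f : (ι → ℝ) → ℂ) :
    ∫ y in unitBox k, f y = ∫ y in unitBox 0, f (y + intVec k) :=
  ((measurePreserving_add_intVec k).integral_comp
    (MeasurableEquiv.addRight (intVec k)).measurableEmbedding f).symm

theorem hasSum_setIntegral_unitBox {f : (ι → ℝ) → ℂ} (hf : Integrable f) :
    HasSum (fun k => ∫ y in unitBox 0, f (y + intVec k)) (∫ y, f y) := by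
  have := hasSum_integral_iUnion (f := f) (μ := volume) measurableSet_unitBox
    (pairwise_disjoint_unitBox (ι := ι)) hf.integrableOn
  rw [iUnion_unitBox, setIntegral_univ] at this
  simp_rw [fun k => setIntegral_unitBox k f] at this
  exact this

theorem lintegral_eq_tsum_unitBox (f : (ι → ℝ) → ℝ≥0∞) :
    ∫⁻ y, f y = ∑' k, ∫⁻ y in unitBox 0, f (y + intVec k) := by
  have h := lintegral_iUnion (μ := volume) (measurableSet_unitBox (ι := ι))
    (pairwise_disjoint_unitBox (ι := ι)) f
  rw [iUnion_unitBox, setLIntegral_univ] at h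
  rw [h]
  congr with k
  exact ((measurePreserving_add_intVec k).lintegral_comp_emb
    (MeasurableEquiv.addRight (intVec k)).measurableEmbedding f).symm

/-- The integer translates of the box cover the space, and `hP` carries `P` from a point of the box
to all its translates. -/
theorem ae_of_ae_unitBox {P : (ι → ℝ) → Prop} (h : ∀ᵐ y ∂volume.restrict (unitBox 0), P y)
    (hP : ∀ y k, P (y - intVec k) → P y) : ∀ᵐ y, P y := by
  rw [← Measure.restrict_univ (μ := volume), ← iUnion_unitBox, ae_restrict_iUnion_iff]
  intro k
  have h2 := (measurePreserving_add_intVec k)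
  rw [← h2.map_eq]
  refine ((MeasurableEquiv.addRight (intVec k)).measurableEmbedding.ae_map_iff).2 ?_
  filter_upwards [h] with y hy
  apply hP _ k
  simpa using hy

theorem norm_mFourier_apply (m : ι → ℤ) (t : UnitAddTorus ι) : ‖mFourier m t‖ = 1 := by
  simp only [mFourier, ContinuousMap.coe_mk, fourier_apply, norm_prod, Circle.norm_coe,
    Finset.prod_const_one]

@[simp] theorem norm_intChar (m : ι → ℤ) (y : ι → ℝ) : ‖intChar m y‖ = 1 :=
  norm_mFourier_apply _ _

theorem intChar_eq_exp (m : ι → ℤ) (y : ι → ℝ) :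
    intChar m y = Complex.exp (2 * Real.pi * Complex.I * ((∑ i, m i * y i : ℝ) : ℂ)) := by
  simp only [intChar, mFourier, ContinuousMap.coe_mk, fourier_coe_apply]
  rw [← Complex.exp_sum]
  congr 1
  push_cast
  rw [Finset.mul_sum]
  refine Finset.sum_congr rfl fun i _ => ?_
  ring

theorem continuous_intChar (m : ι → ℤ) : Continuous (intChar m) := by
  unfold intChar
  refine (mFourier m).continuous.comp (continuous_pi fun i => ?_)
  exact (AddCircle.continuous_mk' 1).comp (continuous_apply i)

theorem intChar_add_intVec (m k : ι → ℤ) (y : ι → ℝ) :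
    intChar m (y + intVec k) = intChar m y := by
  unfold intChar
  congr 1
  ext i
  simp only [Pi.add_apply, intVec, AddCircle.coe_add, add_eq_left]
  exact (AddCircle.coe_eq_zero_iff 1).2 ⟨k i, by simp⟩

theorem integral_mFourier (m : ι → ℤ) :
    ∫ t : UnitAddTorus ι, mFourier m t = if m = 0 then 1 else 0 := by
  classical
  have := (orthonormal_iff_ite.mp (orthonormal_mFourier (d := ι))) 0 m
  rw [ContinuousMap.inner_toLp] at this
  simp only [mFourier_zero] at this
  simpa [eq_comm] using this

/-- Periodization and Fourier series of an integrable function on `ℝ^ι` agree almost everywhere,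
if the Fourier series converges absolutely. -/
theorem tsum_add_intVec_ae_eq {K : (ι → ℝ) → ℂ} (hK : Integrable K) {c : (ι → ℤ) → ℂ}
    (hc : ∀ m, c m = ∫ y, intChar (-m) y * K y) (hs : Summable c) :
    ∀ᵐ y, ∑' k, K (y + intVec k) = ∑' m, c m * intChar m y := by
  set B : Set (ι → ℝ) := unitBox 0
  have hB : B = {x : ι → ℝ | ∀ i, x i ∈ Set.Ioc ((0 : ι → ℝ) i) ((0 : ι → ℝ) i + 1)} := by
    simp [B, unitBox]
  let e := measurableEquivPiIoc (0 : ι → ℝ)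
  -- A measure-preserving section of the quotient map, identifying the torus with the half-open box.
  let sec : UnitAddTorus ι → (ι → ℝ) := fun t => (e t).1
  have hemb : MeasurableEmbedding sec := by
    refine (MeasurableEmbedding.subtype_coe ?_).comp e.measurableEmbedding
    exact MeasurableSet.univ_pi' fun i => measurableSet_Ioc
  have hsec : MeasurePreserving sec volume (volume.restrict B) := by
    refine MeasurePreserving.comp (μb := Measure.comap Subtype.val volume)
      ⟨measurable_subtype_coe, ?_⟩ (measurePreserving_equivPiIoc 0)
    rw [hB]
    exact map_comap_subtype_coe (MeasurableSet.univ_pi' fun _ => measurableSet_Ioc)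
      (volume : Measure (ι → ℝ))
  have hchar : ∀ m t, intChar m (sec t) = mFourier m t := fun m t => by
    unfold intChar
    congr 1
    exact e.symm_apply_apply t
  have htrans : ∀ k, Integrable (fun y => K (y + intVec k)) (volume.restrict B) := fun k =>
    (hK.comp_add_right (intVec k)).integrableOn
  have hfin : ∑' k, ∫⁻ y in B, ‖K (y + intVec k)‖ₑ ≠ ∞ := by
    rw [← lintegral_eq_tsum_unitBox (fun y => ‖K y‖ₑ)]
    exact hK.2.ne
  have hchK : ∀ n k, AEStronglyMeasurable (fun y => intChar n y * K (y + intVec k))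
      (volume.restrict B) := fun n k =>
    (continuous_intChar n).aestronglyMeasurable.mul (htrans k).1
  have hper : Integrable (fun y => ∑' k, K (y + intVec k)) (volume.restrict B) := by
    refine ⟨?_, ?_⟩
    · exact AEStronglyMeasurable.tsum fun k => (htrans k).1
    · refine lt_of_le_of_lt (lintegral_mono fun y => enorm_tsum_le_tsum_enorm) ?_
      rw [lintegral_tsum fun k => (htrans k).1.enorm]
      exact hfin.lt_top
  -- Unfolding: characters are periodic, so integrating the periodization over the box is
  -- integrating `K` over the whole space.
  have hperc : ∀ n, ∫ y in B, intChar n y * ∑' k, K (y + intVec k) = c (-n) := by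
    intro n
    have h1 : ∫ y in B, ∑' k, intChar n y * K (y + intVec k)
        = ∑' k, ∫ y in B, intChar n y * K (y + intVec k) := by
      refine integral_tsum (hchK n) ?_
      simpa [enorm_mul, ← ofReal_norm (intChar n _)] using hfin
    have hint : Integrable (fun y => intChar n y * K y) :=
      hK.bdd_mul (continuous_intChar n).aestronglyMeasurable (c := 1)
        (Eventually.of_forall fun y => by simp)
    have h2 := (hasSum_setIntegral_unitBox hint).tsum_eq
    simp only [intChar_add_intVec] at h2
    simp only [tsum_mul_left] at h1
    rw [h1, h2, hc, neg_neg]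
  -- The Fourier series converges in sup norm, so it is a continuous function. Its coefficients
  -- agree with those of the periodization, and uniqueness applies.
  let S : C(UnitAddTorus ι, ℂ) := ∑' m, c m • mFourier m
  have hS : Summable fun m => c m • mFourier m := by
    refine Summable.of_norm ?_
    simpa [norm_smul, mFourier_norm] using hs.norm
  have hSapp : ∀ t, S t = ∑' m, c m * mFourier m t := fun t => by
    exact (ContinuousMap.tsum_apply hS t).symm
  have hSc : ∀ n, ∫ t, mFourier n t * S t = c (-n) := by
    intro n
    have h1 : ∫ t, ∑' m, mFourier n t * (c m * mFourier m t)
        = ∑' m, ∫ t, mFourier n t * (c m * mFourier m t) := by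
      refine integral_tsum (fun m => ?_) ?_
      · exact Continuous.aestronglyMeasurable (by fun_prop)
      · have : ∀ m (t : UnitAddTorus ι), ‖mFourier n t * (c m * mFourier m t)‖ₑ = ‖c m‖ₑ := by
          intro m t
          have hn : ∀ k, ‖mFourier k t‖ₑ = 1 := fun k => by
            rw [← ofReal_norm]; simp [norm_mFourier_apply]
          rw [enorm_mul, enorm_mul, hn, hn]; simp
        simp only [this, lintegral_const, measure_univ, mul_one]
        simpa [ofReal_norm] using hs.norm.tsum_ofReal_ne_top
    simp only [tsum_mul_left] at h1
    simp only [hSapp]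
    rw [h1, tsum_eq_single (-n)]
    · have : ∀ t : UnitAddTorus ι, mFourier n t * (c (-n) * mFourier (-n) t)
          = c (-n) * mFourier (n + -n) t := fun t => by rw [mFourier_add]; ring
      simp only [this]
      rw [integral_const_mul, integral_mFourier]; simp
    · intro m hm
      have : ∀ t : UnitAddTorus ι, mFourier n t * (c m * mFourier m t)
          = c m * mFourier (n + m) t := fun t => by rw [mFourier_add]; ring
      simp only [this]
      rw [integral_const_mul, integral_mFourier, if_neg, mul_zero]
      intro h
      exact hm (eq_neg_of_add_eq_zero_right h)
  have hperT : Integrable (fun t => ∑' k, K (sec t + intVec k)) :=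
    hsec.integrable_comp_of_integrable hper
  have hzero : (fun t => (∑' k, K (sec t + intVec k)) - S t) =ᵐ[volume] 0 := by
    refine ae_eq_zero_of_mFourierCoeff_eq_zero (hperT.sub ?_) fun n => ?_
    · exact S.continuous.integrable_of_hasCompactSupport (HasCompactSupport.of_compactSpace _)
    · simp only [mul_sub]
      rw [integral_sub, hSc, sub_eq_zero]
      · simp only [← hchar n]
        rw [hsec.integral_comp hemb (fun y => intChar n y * ∑' k, K (y + intVec k)), hperc]
      · exact hperT.bdd_mul (mFourier n).continuous.aestronglyMeasurable (c := 1)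
          (Eventually.of_forall fun t => (norm_mFourier_apply n t).le)
      · exact Continuous.integrable_of_hasCompactSupport (by fun_prop)
          (HasCompactSupport.of_compactSpace _)
  refine ae_of_ae_unitBox ?_ ?_
  · rw [← hsec.map_eq, hemb.ae_map_iff]
    filter_upwards [hzero] with t ht
    simp only [hchar]
    rw [← hSapp]
    exact sub_eq_zero.1 ht
  · intro y k h
    have e1 : ∑' l, K (y - intVec k + intVec l) = ∑' l, K (y + intVec l) := by
      rw [← (Equiv.addRight k).tsum_eq (fun l => K (y - intVec k + intVec l))]
      congr with l
      congr 1
      ext i; simp [intVec]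
    have e2 : ∀ m, intChar m (y - intVec k) = intChar m y := fun m => by
      rw [← intChar_add_intVec m k (y - intVec k), sub_add_cancel]
    simpa only [e1, e2] using h

end Torus

/-! ### Characters, windowed Fourier transforms, and Poisson summation over dilated lattices. -/

section TimeFrequency

variable {d : ℕ}

local notation "E" => EuclideanSpace ℝ (Fin d)

/-- The character `x ↦ exp (2πi⟨ω, x⟩)`. -/
def chr (ω x : E) : ℂ := Complex.exp (2 * Real.pi * Complex.I * ((inner ℝ ω x : ℝ) : ℂ))

@[simp] theorem norm_chr (ω x : E) : ‖chr ω x‖ = 1 := by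
  have : (2 * Real.pi * Complex.I * ((inner ℝ ω x : ℝ) : ℂ))
    = ((2 * Real.pi * inner ℝ ω x : ℝ) : ℂ) * Complex.I := by push_cast; ring
  rw [chr, this, Complex.norm_exp_ofReal_mul_I]

@[simp] theorem enorm_chr (ω x : E) : ‖chr ω x‖ₑ = 1 := by
  rw [← ofReal_norm]; simp

theorem continuous_chr : Continuous fun p : E × E => chr p.1 p.2 := by
  unfold chr; fun_prop

theorem continuous_chr_right (ω : E) : Continuous (chr ω) := by
  unfold chr; fun_prop

theorem chr_add_left (ω η x : E) : chr (ω + η) x = chr ω x * chr η x := by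
  simp only [chr, inner_add_left]; rw [← Complex.exp_add]; push_cast; ring_nf

theorem chr_add_right (ω x y : E) : chr ω (x + y) = chr ω x * chr ω y := by
  simp only [chr, inner_add_right]; rw [← Complex.exp_add]; push_cast; ring_nf

@[simp] theorem chr_zero_left (x : E) : chr 0 x = 1 := by simp [chr]

theorem conj_chr (ω x : E) : conj (chr ω x) = chr (-ω) x := by
  simp only [chr, ← Complex.exp_conj, map_mul, Complex.conj_ofReal, Complex.conj_I, inner_neg_left]
  congr 1
  simp [map_ofNat]

theorem chr_neg_right (ω x : E) : chr ω (-x) = chr (-ω) x := by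
  simp [chr, inner_neg_left, inner_neg_right]

theorem chr_mul_conj (ω x : E) : chr ω x * conj (chr ω x) = 1 := by
  rw [conj_chr, ← chr_add_left]; simp

theorem timeFreqShift_apply (t ω : E) (g : E → ℂ) (x : E) :
    timeFreqShift t ω g x = chr ω x * g (x - t) := rfl

theorem fourier_apply_eq (f : E → ℂ) (ω : E) : 𝓕 f ω = ∫ x, chr (-ω) x * f x := by
  rw [Real.fourier_eq]
  congr with x
  rw [Circle.smul_def, Real.fourierChar_apply, smul_eq_mul]
  simp only [chr, inner_neg_left, real_inner_comm]
  congr 2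
  push_cast
  ring

theorem fourierInv_apply_eq (f : E → ℂ) (ω : E) : 𝓕⁻ f ω = ∫ x, chr ω x * f x := by
  rw [Real.fourierInv_eq]
  congr with x
  rw [Circle.smul_def, Real.fourierChar_apply, smul_eq_mul]
  simp only [chr, real_inner_comm]
  congr 2
  push_cast
  ring

theorem windowedFourier_eq_integral (g f : E → ℂ) (t ω : E) :
    windowedFourier g f (t, ω) = ∫ x, chr (-ω) x * (f x * conj (g (x - t))) := by
  simp only [windowedFourier, pairing, timeFreqShift_apply, map_mul, conj_chr]
  congr with x; ring

theorem windowedFourier_eq_fourier (g f : E → ℂ) (t ω : E) :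
    windowedFourier g f (t, ω) = 𝓕 (fun x => f x * conj (g (x - t))) ω := by
  rw [windowedFourier_eq_integral, fourier_apply_eq]

theorem latticePoint_apply (c : ℝ) (n : Fin d → ℤ) (i : Fin d) :
    latticePoint c n i = c * n i := rfl

theorem inner_latticePoint (s : ℝ) (m : Fin d → ℤ) (x : E) :
    inner ℝ (latticePoint s m) x = ∑ i, (m i : ℝ) * (s * x i) := by
  simp only [PiLp.inner_apply, latticePoint_apply]
  refine Finset.sum_congr rfl fun i _ => ?_
  simp only [RCLike.inner_apply, conj_trivial]; ring

/-- Poisson summation, almost everywhere: if the Fourier transform of an integrable function is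
absolutely summable on a lattice, its periodization is given by the Fourier series. -/
theorem tsum_add_latticePoint_ae_eq {K : E → ℂ} (hK : Integrable K) {s : ℝ} (hs : 0 < s)
    (hsum : Summable fun m : Fin d → ℤ => 𝓕 K (latticePoint s m)) :
    ∀ᵐ x, ∑' k, K (x + latticePoint s⁻¹ k)
      = (s : ℂ) ^ d * ∑' m, 𝓕 K (latticePoint s m) * chr (latticePoint s m) x := by
  let K0 : (Fin d → ℝ) → ℂ := fun z => K (WithLp.toLp 2 z)
  have hK0 : Integrable K0 :=
    (EuclideanSpace.volume_preserving_symm_measurableEquiv_toLp (Fin d)).symm.integrable_comp_of_integrable hK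
  -- The dilation turns $s^{-1}\mathbb Z^d$ into $\mathbb Z^d$; its Jacobian is the factor $s^d$.
  let K1 : (Fin d → ℝ) → ℂ := fun y => K0 (s⁻¹ • y)
  have hK1 : Integrable K1 := hK0.comp_smul (inv_ne_zero hs.ne')
  have hchar : ∀ m (x : E), intChar m (s • WithLp.ofLp x) = chr (latticePoint s m) x := by
    intro m x
    rw [intChar_eq_exp, chr, inner_latticePoint]; simp
  have hneg : ∀ m : Fin d → ℤ, latticePoint s (-m) = -latticePoint s m := fun m => by
    ext i; simp [latticePoint_apply]
  have hc : ∀ m, (s : ℂ) ^ d * 𝓕 K (latticePoint s m) = ∫ y, intChar (-m) y * K1 y := by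
    intro m
    have h1 := Measure.integral_comp_inv_smul_of_nonneg (volume : Measure (Fin d → ℝ))
      (fun z => intChar (-m) (s • z) * K0 z) hs.le
    simp only [smul_inv_smul₀ hs.ne', Module.finrank_fin_fun] at h1
    rw [h1, fourier_apply_eq]
    rw [Complex.real_smul]
    push_cast
    congr 1
    rw [← (EuclideanSpace.volume_preserving_symm_measurableEquiv_toLp (Fin d)).integral_comp
      (MeasurableEquiv.measurableEmbedding _)]
    congr with x
    rw [← hneg, ← hchar]
    rfl
  have hmain := tsum_add_intVec_ae_eq hK1 hc (hsum.mul_left _)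
  have hq : Measure.QuasiMeasurePreserving (fun x : E => s • WithLp.ofLp x) volume volume := by
    have h1 : Measure.QuasiMeasurePreserving (fun z : Fin d → ℝ => s • z) volume volume := by
      refine ⟨measurable_const_smul s, ?_⟩
      rw [Measure.map_addHaar_smul _ hs.ne']
      exact Measure.smul_absolutelyContinuous
    exact h1.comp (EuclideanSpace.volume_preserving_symm_measurableEquiv_toLp
      (Fin d)).quasiMeasurePreserving
  filter_upwards [hq.ae hmain] with x hx
  have e1 : ∀ k : Fin d → ℤ, K1 (s • WithLp.ofLp x + intVec k) = K (x + latticePoint s⁻¹ k) := by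
    intro k
    simp only [K1, K0]
    congr 1
    ext i
    simp [intVec, latticePoint_apply, mul_add, hs.ne']
  simp only [e1, hchar, mul_assoc, tsum_mul_left] at hx
  exact hx

end TimeFrequency

/-! ### Covariance and orthogonality relations of the windowed Fourier transform. -/

section Moyal

variable {d : ℕ}

local notation "E" => EuclideanSpace ℝ (Fin d)

theorem quasiMeasurePreserving_sub_shift :
    Measure.QuasiMeasurePreserving (fun p : (E × E) × E => p.2 - p.1.1) volume volume := by
  exact QuasiMeasurePreserving.prod_of_right (by fun_prop) (Eventually.of_forall fun z =>
    (measurePreserving_sub_right volume z.1).quasiMeasurePreserving)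

theorem aestronglyMeasurable_windowedFourier {f g : E → ℂ} (hf : AEStronglyMeasurable f)
    (hg : AEStronglyMeasurable g) : AEStronglyMeasurable (windowedFourier g f) := by
  have h : AEStronglyMeasurable (fun p : (E × E) × E =>
      f p.2 * conj (chr p.1.2 p.2 * g (p.2 - p.1.1))) volume := by
    refine (hf.comp_quasiMeasurePreserving Measure.quasiMeasurePreserving_snd).mul ?_
    refine Complex.continuous_conj.comp_aestronglyMeasurable ?_
    refine AEStronglyMeasurable.mul ?_
      (hg.comp_quasiMeasurePreserving quasiMeasurePreserving_sub_shift)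
    refine Continuous.aestronglyMeasurable ?_
    exact continuous_chr.comp (by fun_prop : Continuous fun p : (E × E) × E => (p.1.2, p.2))
  exact h.integral_prod_right'

theorem ae_comp_sub {p : E → Prop} (h : ∀ᵐ x, p x) (t : E) : ∀ᵐ x, p (x - t) :=
  (measurePreserving_sub_right volume t).quasiMeasurePreserving.ae h

theorem windowedFourier_congr_ae {f f' g g' : E → ℂ} (hf : f =ᵐ[volume] f')
    (hg : g =ᵐ[volume] g') : windowedFourier g f = windowedFourier g' f' := by
  ext ⟨t, ω⟩
  rw [windowedFourier_eq_integral, windowedFourier_eq_integral]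
  refine integral_congr_ae ?_
  filter_upwards [hf, ae_comp_sub hg t] with x h1 h2
  rw [h1, h2]

theorem pairing_conj_symm (f g : E → ℂ) : conj (pairing f g) = pairing g f := by
  rw [pairing, ← integral_conj]
  simp [pairing, mul_comm]

/-- Time-frequency shifts commute up to a unimodular phase. The phase is kept explicit because it
must cancel in `windowedFourier_neg_mul_pairing`. -/
theorem pairing_timeFreqShift_timeFreqShift (f g : E → ℂ) (w z : E × E) :
    pairing (timeFreqShift w.1 w.2 f) (timeFreqShift z.1 z.2 g)
      = chr (w.2 - z.2) w.1 * windowedFourier g f (z - w) := by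
  rw [show z - w = (z.1 - w.1, z.2 - w.2) from rfl, windowedFourier_eq_integral,
    ← integral_const_mul, pairing, ← integral_add_right_eq_self _ w.1]
  congr with x
  simp only [timeFreqShift_apply, map_mul, conj_chr]
  rw [show x + w.1 - w.1 = x by abel, show x + w.1 - z.1 = x - (z.1 - w.1) by abel,
    show -(z.2 - w.2) = w.2 - z.2 by abel, sub_eq_add_neg w.2 z.2]
  simp only [chr_add_left, chr_add_right]
  ring

theorem enorm_pairing_timeFreqShift_timeFreqShift (f g : E → ℂ) (w z : E × E) :
    ‖pairing (timeFreqShift w.1 w.2 f) (timeFreqShift z.1 z.2 g)‖ₑ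
      = ‖windowedFourier g f (z - w)‖ₑ := by
  rw [pairing_timeFreqShift_timeFreqShift, enorm_mul, enorm_chr, one_mul]

@[simp] theorem timeFreqShift_zero (f : E → ℂ) : timeFreqShift 0 0 f = f := by
  ext x; simp [timeFreqShift_apply]

theorem enorm_windowedFourier_swap (f g : E → ℂ) (z : E × E) :
    ‖windowedFourier g f z‖ₑ = ‖windowedFourier f g (-z)‖ₑ := by
  have := enorm_pairing_timeFreqShift_timeFreqShift g f z 0
  simp only [Prod.fst_zero, Prod.snd_zero, timeFreqShift_zero, zero_sub] at this
  rw [← this, ← pairing_conj_symm, windowedFourier, ← ofReal_norm, ← ofReal_norm]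
  simp

theorem memLp_translate {p : ℝ≥0∞} {f : E → ℂ} (hf : MemLp f p) (t : E) :
    MemLp (fun x => f (x - t)) p :=
  hf.comp_measurePreserving (measurePreserving_sub_right volume t)

theorem memLp_timeFreqShift {p : ℝ≥0∞} {f : E → ℂ} (hf : MemLp f p) (t ω : E) :
    MemLp (timeFreqShift t ω f) p := by
  refine (memLp_translate hf t).of_le ?_ ?_
  · exact (continuous_chr_right ω).aestronglyMeasurable.mul (memLp_translate hf t).1
  · filter_upwards with x
    rw [timeFreqShift_apply, norm_mul, norm_chr, one_mul]

theorem integrable_mul_conj {f g : E → ℂ} (hf : MemLp f 2) (hg : MemLp g 2) :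
    Integrable (fun x => f x * conj (g x)) := by
  refine MemLp.integrable_mul (p := 2) (q := 2) hf ?_
  exact hg.star

theorem exists_norm_windowedFourier_le {f g : E → ℂ} (hf : MemLp f 2) (hg : MemLp g 2) :
    ∃ C, ∀ z, ‖windowedFourier g f z‖ ≤ C := by
  refine ⟨(eLpNorm f 2 volume * eLpNorm g 2 volume).toReal, fun z => ?_⟩
  have hg' := memLp_timeFreqShift hg z.1 z.2
  have hfin : eLpNorm f 2 volume * eLpNorm g 2 volume ≠ ∞ :=
    ENNReal.mul_ne_top hf.2.ne hg.2.ne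
  have h1 : eLpNorm (timeFreqShift z.1 z.2 g) 2 volume = eLpNorm g 2 volume := by
    have : eLpNorm (timeFreqShift z.1 z.2 g) 2 volume = eLpNorm (fun x => g (x - z.1)) 2 volume :=
      eLpNorm_congr_norm_ae (Eventually.of_forall fun x => by
        rw [timeFreqShift_apply, norm_mul, norm_chr, one_mul])
    rw [this]
    exact eLpNorm_comp_measurePreserving hg.1 (measurePreserving_sub_right volume z.1)
  rw [← ENNReal.ofReal_le_ofReal_iff ENNReal.toReal_nonneg, ENNReal.ofReal_toReal hfin,
    ofReal_norm]
  refine (enorm_integral_le_lintegral_enorm _).trans ?_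
  have h2 := ENNReal.lintegral_mul_le_Lp_mul_Lq volume Real.HolderConjugate.two_two
    hf.1.enorm hg'.1.enorm
  rw [← h1]
  rw [eLpNorm_eq_lintegral_rpow_enorm_toReal (by norm_num) (by norm_num),
    eLpNorm_eq_lintegral_rpow_enorm_toReal (by norm_num) (by norm_num)]
  simpa using h2

/-- The polarized Plancherel identity for integrable functions, one of which has an integrable
Fourier transform. -/
theorem integral_fourier_mul_conj_fourier {F G : E → ℂ} (hF : Integrable F) (hG : Integrable G)
    (hF' : Integrable (𝓕 F)) :
    ∫ ω, 𝓕 F ω * conj (𝓕 G ω) = ∫ x, F x * conj (G x) := by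
  have h1 : ∀ ω, conj (𝓕 G ω) = 𝓕⁻ (fun x => conj (G x)) ω := by
    intro ω
    rw [fourier_apply_eq, fourierInv_apply_eq, ← integral_conj]
    simp [conj_chr]
  have hG' : Integrable (fun x => conj (G x)) := by
    simpa using! Complex.conjLIE.toContinuousLinearEquiv.integrable_comp_iff.2 hG
  simp only [h1]
  rw [← integral_fourierInv_mul_eq hF' hG']
  refine integral_congr_ae ?_
  filter_upwards [fourierInv_fourier_ae_eq hF hF'] with x hx
  rw [hx]

/-- The orthogonality relations for windowed Fourier transforms. -/
theorem integral_windowedFourier_mul_conj {f₁ γ₁ f₂ γ₂ : E → ℂ} (hf₁ : MemLp f₁ 2)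
    (hγ₁ : MemLp γ₁ 2) (hf₂ : MemLp f₂ 2) (hγ₂ : MemLp γ₂ 2)
    (h : Integrable (windowedFourier γ₁ f₁)) :
    ∫ z, windowedFourier γ₁ f₁ z * conj (windowedFourier γ₂ f₂ z)
      = pairing f₁ f₂ * pairing γ₂ γ₁ := by
  obtain ⟨C, hC⟩ := exists_norm_windowedFourier_le hf₂ hγ₂
  have hint : Integrable fun z => windowedFourier γ₁ f₁ z * conj (windowedFourier γ₂ f₂ z) := by
    refine h.mul_bdd (c := C) ?_ (Eventually.of_forall fun z => by simpa using hC z)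
    exact Complex.continuous_conj.comp_aestronglyMeasurable
      (aestronglyMeasurable_windowedFourier hf₂.1 hγ₂.1)
  -- For a.e. `t` the slice in the frequency variable is integrable and Plancherel applies. The
  -- result is the convolution of $f_1\bar f_2$ with the reflection of $\gamma_2\bar\gamma_1$, whose
  -- integral factors.
  have hsec : ∀ᵐ t : E, ∫ ω, windowedFourier γ₁ f₁ (t, ω) * conj (windowedFourier γ₂ f₂ (t, ω))
      = ∫ x, (f₁ x * conj (f₂ x)) * (fun y => γ₂ (-y) * conj (γ₁ (-y))) (t - x) := by
    filter_upwards [h.prod_right_ae] with t ht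
    simp only [windowedFourier_eq_fourier] at ht ⊢
    rw [integral_fourier_mul_conj_fourier (integrable_mul_conj hf₁ (memLp_translate hγ₁ t))
      (integrable_mul_conj hf₂ (memLp_translate hγ₂ t)) ht]
    congr with x
    simp only [map_mul, neg_sub, Complex.conj_conj]
    ring
  have e1 : ∫ z, windowedFourier γ₁ f₁ z * conj (windowedFourier γ₂ f₂ z)
      = ∫ t, ∫ ω, windowedFourier γ₁ f₁ (t, ω) * conj (windowedFourier γ₂ f₂ (t, ω)) :=
    integral_prod _ hint
  rw [e1, integral_congr_ae hsec]
  have hconv := integral_convolution (L := ContinuousLinearMap.mul ℂ ℂ) (μ := volume)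
    (ν := volume) (integrable_mul_conj hf₁ hf₂)
    ((integrable_mul_conj hγ₂ hγ₁).comp_neg)
  rw [integral_neg_eq_self (fun x => γ₂ x * conj (γ₁ x))] at hconv
  exact hconv

end Moyal

/-! ### Functions bounded by local averages of integrable functions. -/

section LocallyDominated

set_option linter.unusedSectionVars false

variable {X : Type*} [NormedAddCommGroup X] [MeasureSpace X] [BorelSpace X]
  [SecondCountableTopology X] [ProperSpace X] [(volume : Measure X).IsAddHaarMeasure]

/-- The integral of `H` over the ball of radius `c` around `z`. -/
def ballInt (c : ℝ) (H : X → ℝ≥0∞) (z : X) : ℝ≥0∞ := ∫⁻ y in Metric.ball 0 c, H (z + y)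

/-- A function is locally dominated if, at every scale, it is bounded by the local averages of an
integrable function. -/
def LocallyDominated (F : X → ℝ≥0∞) : Prop :=
  ∀ c : ℝ, 0 < c → ∃ H : X → ℝ≥0∞, Measurable H ∧ ∫⁻ z, H z ≠ ∞ ∧ ∀ z, F z ≤ ballInt c H z

theorem ballInt_eq (c : ℝ) (H : X → ℝ≥0∞) (z : X) :
    ballInt c H z = ∫⁻ w in Metric.ball z c, H w := by
  have h := (measurePreserving_add_left (volume : Measure X) z).restrict_preimage
    (Metric.isOpen_ball (x := z) (ε := c)).measurableSet
  have h2 : (fun y => z + y) ⁻¹' Metric.ball z c = Metric.ball 0 c := by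
    ext y; simp [dist_eq_norm]
  rw [h2] at h
  exact h.lintegral_comp_emb (MeasurableEquiv.addLeft z).measurableEmbedding H

theorem lintegral_ballInt (c : ℝ) {H : X → ℝ≥0∞} (hH : Measurable H) :
    ∫⁻ z, ballInt c H z = volume (Metric.ball (0 : X) c) * ∫⁻ z, H z := by
  unfold ballInt
  rw [lintegral_lintegral_swap]
  · simp only [lintegral_add_right_eq_self]
    simp [mul_comm]
  · exact (hH.comp (measurable_fst.add measurable_snd)).aemeasurable

/-- The separation makes the balls disjoint, so the local integrals add up to at most one integral
over `s`. -/
theorem tsum_ballInt_le {ι : Type*} [Countable ι] (c : ℝ) (H : X → ℝ≥0∞) (pt : ι → X)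
    (hsep : ∀ i j, i ≠ j → 2 * c ≤ dist (pt i) (pt j)) {s : Set X}
    (hs : ∀ i, Metric.ball (pt i) c ⊆ s) :
    ∑' i, ballInt c H (pt i) ≤ ∫⁻ w in s, H w := by
  simp only [ballInt_eq]
  rw [← lintegral_iUnion (fun i => Metric.isOpen_ball.measurableSet)]
  · exact lintegral_mono_set (Set.iUnion_subset hs)
  · intro i j hij
    exact Metric.ball_disjoint_ball (by linarith [hsep i j hij])

theorem LocallyDominated.mono {F F' : X → ℝ≥0∞} (h : LocallyDominated F') {C : ℝ≥0∞} (hC : C ≠ ∞)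
    (hF : ∀ z, F z ≤ C * F' z) : LocallyDominated F := by
  intro c hc
  obtain ⟨H, hm, hi, hb⟩ := h c hc
  refine ⟨fun z => C * H z, hm.const_mul C, ?_, fun z => ?_⟩
  · rw [lintegral_const_mul _ hm]; exact ENNReal.mul_ne_top hC hi
  · have hm' : Measurable fun y => H (z + y) := hm.comp (measurable_const_add z)
    simp only [ballInt]
    rw [lintegral_const_mul _ hm']
    exact (hF z).trans (by gcongr; exact hb z)

theorem LocallyDominated.lintegral_ne_top {F : X → ℝ≥0∞} (h : LocallyDominated F) :
    ∫⁻ z, F z ≠ ∞ := by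
  obtain ⟨H, hm, hi, hb⟩ := h 1 one_pos
  refine ne_top_of_le_ne_top ?_ (lintegral_mono hb)
  rw [lintegral_ballInt _ hm]
  exact ENNReal.mul_ne_top measure_ball_lt_top.ne hi

theorem LocallyDominated.comp_neg {F : X → ℝ≥0∞} (h : LocallyDominated F) :
    LocallyDominated fun z => F (-z) := by
  intro c hc
  obtain ⟨H, hm, hi, hb⟩ := h c hc
  refine ⟨fun z => H (-z), hm.comp measurable_neg, ?_, fun z => ?_⟩
  · rwa [lintegral_neg_eq_self]
  · refine (hb (-z)).trans (le_of_eq ?_)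
    rw [ballInt_eq]
    unfold ballInt
    have h := (Measure.measurePreserving_neg (volume : Measure X)).restrict_preimage
      (Metric.isOpen_ball (x := -z) (ε := c)).measurableSet
    rw [← h.lintegral_comp_emb (MeasurableEquiv.neg X).measurableEmbedding H]
    have h2 : Neg.neg ⁻¹' Metric.ball (-z) c = Metric.ball z c := by
      ext y; simp [dist_eq_norm, norm_sub_rev]
    rw [h2, ← ballInt_eq c (fun a => H (-a))]
    rfl

theorem LocallyDominated.comp_sub {F : X → ℝ≥0∞} (h : LocallyDominated F) (z₀ : X) :
    LocallyDominated fun z => F (z - z₀) := by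
  intro c hc
  obtain ⟨H, hm, hi, hb⟩ := h c hc
  refine ⟨fun z => H (z - z₀), hm.comp (measurable_sub_const z₀), ?_, fun z => ?_⟩
  · rwa [lintegral_sub_right_eq_self]
  · refine (hb (z - z₀)).trans (le_of_eq ?_)
    unfold ballInt
    congr with y
    congr 1
    abel

/-- Convolution with an integrable function preserves local domination. -/
theorem LocallyDominated.of_conv_le {F F' G : X → ℝ≥0∞} (h : LocallyDominated F')
    (hG : AEMeasurable G) (hGi : ∫⁻ z, G z ≠ ∞) {C : ℝ≥0∞} (hC : C ≠ ∞)
    (hF : ∀ z, C * F z ≤ ∫⁻ w, G w * F' (z - w)) (hC0 : C ≠ 0) : LocallyDominated F := by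
  intro c hc
  obtain ⟨H, hm, hi, hb⟩ := h c hc
  have hGm : Measurable (hG.mk G) := hG.measurable_mk
  have hjoint : Measurable fun p : X × X => hG.mk G p.2 * H (p.1 - p.2) :=
    (hGm.comp measurable_snd).mul (hm.comp (measurable_fst.sub measurable_snd))
  have hK : Measurable fun z => ∫⁻ w, hG.mk G w * H (z - w) := hjoint.lintegral_prod_right'
  -- The new dominating function is $C^{-1}\,G*H$, since averaging over balls commutes with
  -- convolution. A measurable representative of `G` is used for Tonelli.
  refine ⟨fun z => C⁻¹ * ∫⁻ w, hG.mk G w * H (z - w), hK.const_mul _, ?_, fun z => ?_⟩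
  · rw [lintegral_const_mul _ hK, lintegral_lintegral_swap hjoint.aemeasurable]
    refine ENNReal.mul_ne_top (ENNReal.inv_ne_top.2 hC0) ?_
    have : ∀ w, ∫⁻ z, hG.mk G w * H (z - w) = hG.mk G w * ∫⁻ z, H z := fun w => by
      have hm' : Measurable fun z => H (z - w) := hm.comp (measurable_sub_const w)
      rw [lintegral_const_mul _ hm', lintegral_sub_right_eq_self]
    simp only [this]
    rw [lintegral_mul_const _ hGm]
    refine ENNReal.mul_ne_top ?_ hi
    rwa [← lintegral_congr_ae hG.ae_eq_mk]
  · have h1 : F z ≤ C⁻¹ * ∫⁻ w, G w * F' (z - w) := by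
      rw [← ENNReal.div_eq_inv_mul, ENNReal.le_div_iff_mul_le (Or.inl hC0) (Or.inl hC), mul_comm]
      exact hF z
    refine h1.trans ?_
    have hK' : Measurable fun y => ∫⁻ w, hG.mk G w * H (z + y - w) :=
      hK.comp (measurable_const_add z)
    simp only [ballInt]
    rw [lintegral_const_mul _ hK']
    refine mul_le_mul' le_rfl ?_
    rw [lintegral_lintegral_swap]
    · rw [lintegral_congr_ae (g := fun w => hG.mk G w * F' (z - w))]
      · refine lintegral_mono fun w => ?_
        have hm' : Measurable fun y => H (z + y - w) :=
          hm.comp ((measurable_const_add z).sub_const w)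
        rw [lintegral_const_mul _ hm']
        gcongr
        refine (hb (z - w)).trans (le_of_eq ?_)
        unfold ballInt
        congr with y
        congr 1
        abel
      · filter_upwards [hG.ae_eq_mk] with w hw
        rw [hw]
    · refine Measurable.aemeasurable ?_
      exact hjoint.comp ((measurable_const_add z).comp measurable_fst |>.prodMk measurable_snd)

end LocallyDominated

/-! ### The Gaussian window and its windowed Fourier transform. -/

section Gaussian

variable {d : ℕ}

local notation "E" => EuclideanSpace ℝ (Fin d)

theorem integrable_exp_neg_sq_norm {a : ℝ} (ha : 0 < a) :
    Integrable fun x : E => Real.exp (-a * ‖x‖ ^ 2) := by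
  have h := (GaussianFourier.integrable_cexp_neg_mul_sq_norm_add (V := E) (b := (a : ℂ))
    (by simpa using ha) 0 0).norm
  refine h.congr (Eventually.of_forall fun x => ?_)
  simp only [zero_mul, add_zero, Complex.norm_exp]
  congr 1
  norm_cast

/-- Halving the exponent absorbs a shift: $\|p+q\|^2\le2\|p\|^2+2c^2$ for $\|q\|\le c$, at the cost
of the factor $e^{2ac^2}$. -/
theorem locallyDominated_gaussian {a : ℝ} (ha : 0 < a) :
    LocallyDominated fun z : E × E =>
      ENNReal.ofReal (Real.exp (-a * (‖z.1‖ ^ 2 + ‖z.2‖ ^ 2))) := by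
  intro c hc
  set v := volume (Metric.ball (0 : E × E) c) with hv
  have hv0 : v ≠ 0 := (Metric.measure_ball_pos volume 0 hc).ne'
  have hv1 : v ≠ ∞ := measure_ball_lt_top.ne
  set M : ℝ≥0∞ := ENNReal.ofReal (Real.exp (2 * a * c ^ 2)) * v⁻¹
  have hmeas : Measurable fun z : E × E =>
      ENNReal.ofReal (Real.exp (-(a / 2) * (‖z.1‖ ^ 2 + ‖z.2‖ ^ 2))) := by fun_prop
  refine ⟨fun z => M * ENNReal.ofReal (Real.exp (-(a / 2) * (‖z.1‖ ^ 2 + ‖z.2‖ ^ 2))),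
    hmeas.const_mul _, ?_, fun z => ?_⟩
  · rw [lintegral_const_mul _ hmeas]
    refine ENNReal.mul_ne_top (ENNReal.mul_ne_top ENNReal.ofReal_ne_top
      (ENNReal.inv_ne_top.2 hv0)) ?_
    have h := (integrable_exp_neg_sq_norm (d := d) (half_pos ha)).mul_prod
      (integrable_exp_neg_sq_norm (d := d) (half_pos ha))
    have h2 := h.2
    rw [hasFiniteIntegral_iff_norm] at h2
    refine ne_of_lt (lt_of_le_of_lt (le_of_eq ?_) h2)
    refine lintegral_congr fun p => ?_
    rw [← Real.exp_add, Real.norm_of_nonneg (Real.exp_pos _).le]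
    ring_nf
  · unfold ballInt
    have key : ∀ y ∈ Metric.ball (0 : E × E) c,
        ENNReal.ofReal (Real.exp (-a * (‖z.1‖ ^ 2 + ‖z.2‖ ^ 2))) * v⁻¹
        ≤ M * ENNReal.ofReal (Real.exp (-(a / 2) * (‖(z + y).1‖ ^ 2 + ‖(z + y).2‖ ^ 2))) := by
      intro y hy
      rw [mem_ball_zero_iff] at hy
      have hy1 : ‖y.1‖ ≤ c := (norm_fst_le y).trans hy.le
      have hy2 : ‖y.2‖ ≤ c := (norm_snd_le y).trans hy.le
      have hb : ∀ p q : E, ‖q‖ ≤ c → ‖p + q‖ ^ 2 ≤ 2 * ‖p‖ ^ 2 + 2 * c ^ 2 := by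
        intro p q hq
        have h1 := norm_add_le p q
        have h2 : ‖p + q‖ ^ 2 ≤ (‖p‖ + ‖q‖) ^ 2 := by gcongr
        have h3 : ‖q‖ ^ 2 ≤ c ^ 2 := by gcongr
        nlinarith [sq_nonneg (‖p‖ - ‖q‖)]
      have h1 := hb z.1 y.1 hy1
      have h2 := hb z.2 y.2 hy2
      rw [mul_right_comm, ← ENNReal.ofReal_mul (Real.exp_pos _).le, ← Real.exp_add]
      gcongr
      simp only [Prod.fst_add, Prod.snd_add]
      nlinarith
    calc ENNReal.ofReal (Real.exp (-a * (‖z.1‖ ^ 2 + ‖z.2‖ ^ 2)))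
        = ∫⁻ y in Metric.ball (0 : E × E) c,
          ENNReal.ofReal (Real.exp (-a * (‖z.1‖ ^ 2 + ‖z.2‖ ^ 2))) * v⁻¹ := by
          rw [setLIntegral_const, mul_assoc, ENNReal.inv_mul_cancel hv0 hv1, mul_one]
      _ ≤ _ := setLIntegral_mono' Metric.isOpen_ball.measurableSet key

instance isAddHaarMeasure_volume_prod : (volume : Measure (E × E)).IsAddHaarMeasure :=
  inferInstanceAs (Measure.prod volume volume).IsAddHaarMeasure

/-- The Gaussian window `exp (-π‖x‖²)`. -/
def gauss (x : E) : ℂ := ((Real.exp (-Real.pi * ‖x‖ ^ 2) : ℝ) : ℂ)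

theorem norm_gauss (x : E) : ‖gauss x‖ = Real.exp (-Real.pi * ‖x‖ ^ 2) := by
  rw [gauss, Complex.norm_real, Real.norm_of_nonneg (Real.exp_pos _).le]

theorem continuous_gauss : Continuous (gauss (d := d)) := by
  unfold gauss; fun_prop

theorem memLp_gauss : MemLp (gauss (d := d)) 2 := by
  rw [memLp_two_iff_integrable_sq_norm continuous_gauss.aestronglyMeasurable]
  refine (integrable_exp_neg_sq_norm (d := d) (a := 2 * Real.pi) (by positivity)).congr
    (Eventually.of_forall fun x => ?_)
  simp only [norm_gauss, ← Real.exp_nat_mul]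
  ring_nf

/-- Recentring at $t/2$ and the parallelogram law separate the dependence on $t$ from the
integration variable. -/
theorem windowedFourier_gauss (t ω : E) :
    windowedFourier gauss gauss (t, ω) = chr (-ω) ((2⁻¹ : ℝ) • t) *
      (((Real.exp (-(Real.pi / 2) * ‖t‖ ^ 2) : ℝ) : ℂ) *
        𝓕 (fun x : E => Complex.exp (-(2 * Real.pi : ℂ) * ‖x‖ ^ 2)) ω) := by
  rw [windowedFourier_eq_integral, fourier_apply_eq, ← integral_const_mul, ← integral_const_mul,
    ← integral_add_right_eq_self _ ((2⁻¹ : ℝ) • t)]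
  congr with x
  have h1 : ‖x + (2⁻¹ : ℝ) • t‖ ^ 2 + ‖x + (2⁻¹ : ℝ) • t - t‖ ^ 2
      = 2 * ‖x‖ ^ 2 + ‖t‖ ^ 2 / 2 := by
    have : x + (2⁻¹ : ℝ) • t - t = x - (2⁻¹ : ℝ) • t := by module
    rw [this]
    have := parallelogram_law_with_norm ℝ x ((2⁻¹ : ℝ) • t)
    have h2 : ‖(2⁻¹ : ℝ) • t‖ = 2⁻¹ * ‖t‖ := by rw [norm_smul]; norm_num
    rw [h2] at this
    nlinarith
  have h3 : gauss (x + (2⁻¹ : ℝ) • t) * conj (gauss (x + (2⁻¹ : ℝ) • t - t))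
      = ((Real.exp (-(Real.pi / 2) * ‖t‖ ^ 2) : ℝ) : ℂ) *
        Complex.exp (-(2 * Real.pi : ℂ) * ‖x‖ ^ 2) := by
    have h4 : Complex.exp (-(2 * Real.pi : ℂ) * ‖x‖ ^ 2)
        = ((Real.exp (-(2 * Real.pi) * ‖x‖ ^ 2) : ℝ) : ℂ) := by push_cast; rfl
    rw [h4]
    simp only [gauss, Complex.conj_ofReal, ← Complex.ofReal_mul, ← Real.exp_add]
    congr 2
    linear_combination (-Real.pi) * h1
  rw [h3, chr_add_right]
  ring

theorem locallyDominated_windowedFourier_gauss :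
    LocallyDominated fun z : E × E => ‖windowedFourier gauss gauss z‖ₑ := by
  refine (locallyDominated_gaussian (d := d) (a := Real.pi / 2) (by positivity)).mono
    (C := ‖((Real.pi : ℂ) / (2 * Real.pi : ℂ)) ^ ((Module.finrank ℝ E : ℂ) / 2)‖ₑ)
    enorm_ne_top fun z => ?_
  obtain ⟨t, ω⟩ := z
  rw [windowedFourier_gauss, fourier_gaussian_innerProductSpace (by simp [Real.pi_pos])]
  rw [enorm_mul, enorm_mul, enorm_mul, enorm_chr, one_mul, mul_left_comm]
  gcongr
  rw [← ofReal_norm, ← ofReal_norm, ← ENNReal.ofReal_mul (norm_nonneg _), Complex.norm_real,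
    Real.norm_of_nonneg (Real.exp_pos _).le]
  have h4 : Complex.exp (-(Real.pi : ℂ) ^ 2 * ‖ω‖ ^ 2 / (2 * Real.pi : ℂ))
        = ((Real.exp (-(Real.pi / 2) * ‖ω‖ ^ 2) : ℝ) : ℂ) := by
    push_cast
    congr 1
    have : (Real.pi : ℂ) ≠ 0 := by exact_mod_cast Real.pi_ne_zero
    field_simp
  rw [h4, Complex.norm_real, Real.norm_of_nonneg (Real.exp_pos _).le, ← Real.exp_add]
  exact ENNReal.ofReal_le_ofReal (Real.exp_le_exp.2 (by simp only; linarith))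

end Gaussian

/-! ### Local domination for windows in $S_0$. -/

section FeichtingerAlgebra

variable {d : ℕ}

local notation "E" => EuclideanSpace ℝ (Fin d)

theorem enorm_conj (z : ℂ) : ‖conj z‖ₑ = ‖z‖ₑ := by
  rw [← ofReal_norm, ← ofReal_norm, Complex.norm_conj]

theorem enorm_pairing_mul_le {f₁ γ₁ f₂ γ₂ : E → ℂ} (hf₁ : MemLp f₁ 2)
    (hγ₁ : MemLp γ₁ 2) (hf₂ : MemLp f₂ 2) (hγ₂ : MemLp γ₂ 2)
    (h : Integrable (windowedFourier γ₁ f₁)) :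
    ‖pairing γ₂ γ₁‖ₑ * ‖pairing f₁ f₂‖ₑ
      ≤ ∫⁻ z, ‖windowedFourier γ₁ f₁ z‖ₑ * ‖windowedFourier γ₂ f₂ z‖ₑ := by
  rw [mul_comm, ← enorm_mul, ← integral_windowedFourier_mul_conj hf₁ hγ₁ hf₂ hγ₂ h]
  refine (enorm_integral_le_lintegral_enorm _).trans (le_of_eq ?_)
  simp only [enorm_mul, enorm_conj]

theorem timeFreqShift_timeFreqShift (w z : E × E) (f : E → ℂ) (x : E) :
    timeFreqShift w.1 w.2 (timeFreqShift z.1 z.2 f) x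
      = chr (-z.2) w.1 * timeFreqShift (w + z).1 (w + z).2 f x := by
  simp only [timeFreqShift_apply, Prod.fst_add, Prod.snd_add]
  rw [sub_eq_add_neg x w.1, chr_add_right, chr_neg_right, chr_add_left,
    show x + -w.1 - z.1 = x - (w.1 + z.1) by abel]
  ring

theorem enorm_windowedFourier_timeFreqShift (f g : E → ℂ) (z z₀ w : E × E) :
    ‖windowedFourier (timeFreqShift z₀.1 z₀.2 g) (timeFreqShift z.1 z.2 f) w‖ₑ
      = ‖windowedFourier g f (w + z₀ - z)‖ₑ := by
  rw [← enorm_pairing_timeFreqShift_timeFreqShift f g z (w + z₀)]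
  have : windowedFourier (timeFreqShift z₀.1 z₀.2 g) (timeFreqShift z.1 z.2 f) w
      = conj (chr (-z₀.2) w.1) *
        pairing (timeFreqShift z.1 z.2 f) (timeFreqShift (w + z₀).1 (w + z₀).2 g) := by
    rw [windowedFourier, pairing, pairing, ← integral_const_mul]
    congr with x
    rw [timeFreqShift_timeFreqShift, map_mul]
    ring
  rw [this, enorm_mul, enorm_conj, enorm_chr, one_mul]

/-- With $\varphi$ the Gaussian and $V_gf=\langle f,\tau(\cdot)g\rangle$, the orthogonality
relations give $|V_\varphi g(z_0)|\,|V_\varphi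
g(z)|\le\int|V_gg(w)|\,|V_\varphi\varphi(z-z_0-w)|\,dw$. One divides by the value at a point $z_0$
where $V_\varphi g$ does not vanish. -/
theorem MemS0.locallyDominated_gauss {g : E → ℂ} (hg : MemS0 g) :
    LocallyDominated fun z => ‖windowedFourier gauss g z‖ₑ := by
  by_cases h0 : ∀ z, windowedFourier gauss g z = 0
  · exact locallyDominated_windowedFourier_gauss.mono ENNReal.one_ne_top fun z => by simp [h0]
  push Not at h0
  obtain ⟨z₀, hz₀⟩ := h0
  refine (locallyDominated_windowedFourier_gauss.comp_sub z₀).of_conv_le hg.2.1.enorm hg.2.2.ne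
    (C := ‖windowedFourier gauss g z₀‖ₑ) enorm_ne_top (fun z => ?_) (by simpa using hz₀)
  have h1 := enorm_pairing_mul_le hg.1 hg.1 (memLp_timeFreqShift (memLp_gauss (d := d)) z.1 z.2)
    (memLp_timeFreqShift memLp_gauss z₀.1 z₀.2) hg.2
  simp only [enorm_windowedFourier_timeFreqShift] at h1
  rw [← pairing_conj_symm, enorm_conj] at h1
  refine h1.trans (le_of_eq ?_)
  congr with w
  rw [enorm_windowedFourier_swap gauss gauss (w + z₀ - z)]
  congr 3
  abel

theorem MemS0.integrable_gauss {g : E → ℂ} (hg : MemS0 g) :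
    Integrable (windowedFourier gauss g) :=
  ⟨aestronglyMeasurable_windowedFourier hg.1.1 continuous_gauss.aestronglyMeasurable,
    hg.locallyDominated_gauss.lintegral_ne_top.lt_top⟩

theorem pairing_gauss_ne_zero : pairing (gauss (d := d)) gauss ≠ 0 := by
  have h := windowedFourier_gauss (0 : E) 0
  have h2 : windowedFourier gauss gauss ((0 : E), (0 : E)) = pairing (gauss (d := d)) gauss := by
    simp [windowedFourier]
  rw [← h2, h, fourier_gaussian_innerProductSpace (by simp [Real.pi_pos])]
  have : (Real.pi : ℂ) ≠ 0 := by exact_mod_cast Real.pi_ne_zero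
  simp only [neg_zero, chr_zero_left]
  refine mul_ne_zero one_ne_zero (mul_ne_zero (by simp) (mul_ne_zero ?_ (Complex.exp_ne_zero _)))
  rw [Ne, Complex.cpow_eq_zero_iff]
  simp [this]

/-- For `g, γ ∈ S₀` the windowed Fourier transform `⟨γ, τ(z) g⟩` is locally dominated. -/
theorem MemS0.locallyDominated {g γ : E → ℂ} (hg : MemS0 g) (hγ : MemS0 γ) :
    LocallyDominated fun z => ‖windowedFourier g γ z‖ₑ := by
  -- $\langle\varphi,\varphi\rangle V_g\gamma$ is bounded by $|V_\varphi\gamma|$ convolved with the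
  -- reflection of $|V_\varphi g|$.
  refine hg.locallyDominated_gauss.comp_neg.of_conv_le hγ.integrable_gauss.1.enorm
    hγ.integrable_gauss.2.ne (C := ‖pairing (gauss (d := d)) gauss‖ₑ) enorm_ne_top (fun z => ?_)
    (by simpa using pairing_gauss_ne_zero)
  have h1 := enorm_pairing_mul_le hγ.1 memLp_gauss (memLp_timeFreqShift hg.1 z.1 z.2)
    (memLp_gauss (d := d)) hγ.integrable_gauss
  refine h1.trans (le_of_eq ?_)
  congr with w
  congr 1
  have := enorm_windowedFourier_timeFreqShift g gauss z 0 w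
  simp only [Prod.fst_zero, Prod.snd_zero, timeFreqShift_zero, add_zero] at this
  rw [this]
  congr 2
  abel

/-- Functions in `S₀` are almost everywhere bounded by local averages of integrable functions. -/
theorem MemS0.exists_enorm_le_ballInt {h : E → ℂ} (hh : MemS0 h) {c : ℝ} (hc : 0 < c) :
    ∃ H : E → ℝ≥0∞, Measurable H ∧ ∫⁻ x, H x ≠ ∞ ∧ ∀ᵐ x, ‖h x‖ₑ ≤ ballInt c H x := by
  have hsm := hh.1.1
  set h' := hsm.mk h
  have hh' : Measurable h' := hsm.stronglyMeasurable_mk.measurable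
  have hV : windowedFourier gauss h = windowedFourier gauss h' :=
    windowedFourier_congr_ae hsm.ae_eq_mk (ae_eq_refl _)
  have hint : Integrable (windowedFourier gauss h') := hV ▸ hh.integrable_gauss
  have hL2 : MemLp h' 2 := (memLp_congr_ae hsm.ae_eq_mk).1 hh.1
  have hN : AEMeasurable fun t : E => ∫⁻ ω, ‖windowedFourier gauss h' (t, ω)‖ₑ :=
    hint.1.enorm.lintegral_prod_right'
  set N := hN.mk _ with hNdef
  have hNm : Measurable N := hN.measurable_mk
  have hNi : ∫⁻ t, N t ≠ ∞ := by
    rw [← lintegral_congr_ae hN.ae_eq_mk, ← lintegral_prod _ hint.1.enorm]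
    exact hint.2.ne
  -- Fourier inversion in the frequency variable recovers $h'(x)\overline{\varphi(x-t)}$, bounded by
  -- the $L^1$ norm of the slice at $t$. Exchanging the null sets then allows averaging over $t$
  -- near a fixed $x$, where the Gaussian is at least `m`.
  have h1 : ∀ᵐ t : E, ∀ᵐ x : E, ‖h' x * conj (gauss (x - t))‖ₑ ≤ N t := by
    filter_upwards [hint.prod_right_ae, hN.ae_eq_mk] with t ht htN
    rw [hNdef, ← htN]
    simp only [windowedFourier_eq_fourier] at ht ⊢
    have hF := integrable_mul_conj hL2 (memLp_translate (memLp_gauss (d := d)) t)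
    filter_upwards [fourierInv_fourier_ae_eq hF ht] with x hx
    rw [← hx, fourierInv_apply_eq]
    refine (enorm_integral_le_lintegral_enorm _).trans (le_of_eq ?_)
    simp only [enorm_mul, enorm_chr, one_mul]
  have h2 : ∀ᵐ x : E, ∀ᵐ t : E, ‖h' x * conj (gauss (x - t))‖ₑ ≤ N t := by
    rw [Measure.ae_ae_comm]
    · exact h1
    · refine measurableSet_le (Measurable.enorm ?_) (hNm.comp measurable_snd)
      refine (hh'.comp measurable_fst).mul ?_
      exact (Complex.continuous_conj.comp (continuous_gauss.comp
        (continuous_fst.sub continuous_snd))).measurable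
  set v := volume (Metric.ball (0 : E) c)
  have hv0 : v ≠ 0 := (Metric.measure_ball_pos volume 0 hc).ne'
  have hv1 : v ≠ ∞ := measure_ball_lt_top.ne
  set m : ℝ≥0∞ := ENNReal.ofReal (Real.exp (-Real.pi * c ^ 2))
  have hm0 : m ≠ 0 := by simp [m, Real.exp_pos]
  have hm1 : m ≠ ∞ := ENNReal.ofReal_ne_top
  refine ⟨fun t => (m * v)⁻¹ * N t, hNm.const_mul _, ?_, ?_⟩
  · rw [lintegral_const_mul _ hNm]
    exact ENNReal.mul_ne_top (ENNReal.inv_ne_top.2 (mul_ne_zero hm0 hv0)) hNi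
  · filter_upwards [h2, hsm.ae_eq_mk] with x hx hxe
    rw [ballInt_eq, lintegral_const_mul _ hNm, hxe, ← ENNReal.div_eq_inv_mul,
      ENNReal.le_div_iff_mul_le (Or.inl (mul_ne_zero hm0 hv0))
        (Or.inl (ENNReal.mul_ne_top hm1 hv1)), ← mul_assoc]
    have hvx : volume (Metric.ball x c) = v := Measure.addHaar_ball_center _ _ _
    rw [← hvx, ← setLIntegral_const]
    refine lintegral_mono_ae ?_
    filter_upwards [ae_restrict_of_ae hx, ae_restrict_mem Metric.isOpen_ball.measurableSet]
      with t ht htm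
    refine le_trans ?_ ht
    rw [enorm_mul, enorm_conj]
    gcongr
    rw [← ofReal_norm, norm_gauss]
    refine ENNReal.ofReal_le_ofReal (Real.exp_le_exp.2 ?_)
    have h3 : ‖x - t‖ ≤ c := by
      rw [mem_ball_iff_norm'] at htm; exact htm.le
    have h4 : ‖x - t‖ ^ 2 ≤ c ^ 2 := by gcongr
    nlinarith [Real.pi_pos]

end FeichtingerAlgebra

/-! ### Sampling on lattices and the Janssen identity in $S_0$. -/

section Lattice

variable {d : ℕ}

local notation "E" => EuclideanSpace ℝ (Fin d)

theorem summable_norm_of_tsum_enorm_ne_top {ι : Type*} {u : ι → ℂ} (h : ∑' i, ‖u i‖ₑ ≠ ∞) :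
    Summable fun i => ‖u i‖ := by
  simpa using ENNReal.summable_toReal h

theorem latticePoint_neg (c : ℝ) (n : Fin d → ℤ) : latticePoint c (-n) = -latticePoint c n := by
  ext i; simp [latticePoint_apply]

@[simp] theorem latticePoint_zero (c : ℝ) : latticePoint c (0 : Fin d → ℤ) = 0 := by
  ext i; simp [latticePoint_apply]

theorem latticePoint_sub (c : ℝ) (n m : Fin d → ℤ) :
    latticePoint c (n - m) = latticePoint c n - latticePoint c m := by
  ext i; simp [latticePoint_apply, mul_sub]

theorem le_norm_latticePoint {c : ℝ} (hc : 0 < c) {n : Fin d → ℤ} (hn : n ≠ 0) :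
    c ≤ ‖latticePoint c n‖ := by
  obtain ⟨i, hi⟩ := Function.ne_iff.1 hn
  refine le_trans ?_ (PiLp.norm_apply_le (latticePoint c n) i)
  rw [latticePoint_apply, norm_mul, Real.norm_of_nonneg hc.le]
  have h1 : (1 : ℝ) ≤ ‖((n i : ℤ) : ℝ)‖ := by
    rw [Real.norm_eq_abs]
    exact_mod_cast Int.one_le_abs hi
  nlinarith

theorem le_dist_latticePoint {c : ℝ} (hc : 0 < c) {n m : Fin d → ℤ} (hn : n ≠ m) :
    c ≤ dist (latticePoint c n) (latticePoint c m) := by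
  rw [dist_eq_norm, ← latticePoint_sub]
  exact le_norm_latticePoint hc (sub_ne_zero.2 hn)

/-- The point `(αn, βm)` of the time-frequency plane. -/
def tfPoint (α β : ℝ) (nm : (Fin d → ℤ) × (Fin d → ℤ)) : E × E :=
  (latticePoint α nm.1, latticePoint β nm.2)

theorem tfPoint_sub (α β : ℝ) (i j : (Fin d → ℤ) × (Fin d → ℤ)) :
    tfPoint α β (i - j) = tfPoint α β i - tfPoint α β j := by
  simp [tfPoint, latticePoint_sub]

theorem tfPoint_neg (α β : ℝ) (i : (Fin d → ℤ) × (Fin d → ℤ)) :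
    tfPoint α β (-i) = -tfPoint α β i := by
  simp [tfPoint, latticePoint_neg]

@[simp] theorem tfPoint_zero (α β : ℝ) : tfPoint α β (0 : (Fin d → ℤ) × (Fin d → ℤ)) = 0 := by
  simp [tfPoint]

theorem le_norm_tfPoint {α β : ℝ} (hα : 0 < α) (hβ : 0 < β) {i : (Fin d → ℤ) × (Fin d → ℤ)}
    (hi : i ≠ 0) : min α β ≤ ‖tfPoint α β i‖ := by
  by_cases h : i.1 = 0
  · have h2 : i.2 ≠ 0 := fun h2 => hi (Prod.ext h h2)
    exact (min_le_right _ _).trans ((le_norm_latticePoint hβ h2).trans (norm_snd_le (tfPoint α β i)))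
  · exact (min_le_left _ _).trans ((le_norm_latticePoint hα h).trans (norm_fst_le (tfPoint α β i)))

theorem le_dist_tfPoint {α β : ℝ} (hα : 0 < α) (hβ : 0 < β) {i j : (Fin d → ℤ) × (Fin d → ℤ)}
    (hi : i ≠ j) : min α β ≤ dist (tfPoint α β i) (tfPoint α β j) := by
  rw [dist_eq_norm, ← tfPoint_sub]
  exact le_norm_tfPoint hα hβ (sub_ne_zero.2 hi)

theorem LocallyDominated.tsum_tfPoint_ne_top {F : E × E → ℝ≥0∞} (hF : LocallyDominated F)
    {α β : ℝ} (hα : 0 < α) (hβ : 0 < β) : ∑' i, F (tfPoint α β i) ≠ ∞ := by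
  obtain ⟨H, hm, hi, hb⟩ := hF (min α β / 2) (by positivity)
  refine ne_top_of_le_ne_top hi ?_
  rw [← setLIntegral_univ]
  refine (ENNReal.tsum_le_tsum fun i => hb _).trans
    (tsum_ballInt_le _ H _ (fun i j hij => ?_) fun i => Set.subset_univ _)
  linarith [le_dist_tfPoint hα hβ hij]

/-- The values of a locally dominated function at the nonzero points of a lattice tend to zero in
`ℓ¹` as the lattice is dilated. -/
theorem LocallyDominated.tendsto_tsum_tfPoint {F : E × E → ℝ≥0∞} (hF : LocallyDominated F) :
    Tendsto (fun ab : ℝ × ℝ => ∑' i : {i : (Fin d → ℤ) × (Fin d → ℤ) // i ≠ 0},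
      F (tfPoint ab.2⁻¹ ab.1⁻¹ i)) (𝓝[>] (0 : ℝ) ×ˢ 𝓝[>] (0 : ℝ)) (𝓝 0) := by
  -- Once $a,b\le1$ the adjoint lattice is 1-separated, so radius $1/2$ serves all of them at once.
  -- The balls around nonzero points lie in `s ab`, which escapes to infinity.
  obtain ⟨H, hm, hi, hb⟩ := hF (1 / 2) (by norm_num)
  let s : ℝ × ℝ → Set (E × E) := fun ab => {w | min ab.2⁻¹ ab.1⁻¹ - 1 ≤ ‖w‖}
  have hs : ∀ ab, MeasurableSet (s ab) := fun ab => measurableSet_le measurable_const measurable_norm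
  have ha : Tendsto (fun ab : ℝ × ℝ => ab.1⁻¹) (𝓝[>] (0 : ℝ) ×ˢ 𝓝[>] (0 : ℝ)) atTop :=
    tendsto_inv_nhdsGT_zero.comp tendsto_fst
  have hb' : Tendsto (fun ab : ℝ × ℝ => ab.2⁻¹) (𝓝[>] (0 : ℝ) ×ˢ 𝓝[>] (0 : ℝ)) atTop :=
    tendsto_inv_nhdsGT_zero.comp tendsto_snd
  have hlim : Tendsto (fun ab : ℝ × ℝ => ∫⁻ w, (s ab).indicator H w)
      (𝓝[>] (0 : ℝ) ×ˢ 𝓝[>] (0 : ℝ)) (𝓝 (∫⁻ _ : E × E, 0)) := by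
    refine tendsto_lintegral_filter_of_dominated_convergence H ?_ ?_ hi ?_
    · exact Eventually.of_forall fun ab => hm.indicator (hs ab)
    · exact Eventually.of_forall fun ab => Eventually.of_forall fun w => Set.indicator_le_self _ _ _
    · refine Eventually.of_forall fun w => tendsto_const_nhds.congr' ?_
      filter_upwards [ha.eventually_gt_atTop (‖w‖ + 1), hb'.eventually_gt_atTop (‖w‖ + 1)]
        with ab h1 h2
      rw [Set.indicator_of_notMem]
      simp only [s, Set.mem_ofPred_eq, not_le]
      have := lt_min h2 h1
      linarith
  rw [lintegral_zero] at hlim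
  refine tendsto_of_tendsto_of_tendsto_of_le_of_le' tendsto_const_nhds hlim
    (Eventually.of_forall fun _ => zero_le) ?_
  filter_upwards [ha.eventually_ge_atTop 1, hb'.eventually_ge_atTop 1] with ab h1 h2
  have p1 : 0 < ab.1⁻¹ := by linarith
  have p2 : 0 < ab.2⁻¹ := by linarith
  rw [lintegral_indicator (hs ab)]
  refine (ENNReal.tsum_le_tsum fun i => hb _).trans
    (tsum_ballInt_le _ H _ (fun i j hij => ?_) fun i => ?_)
  · have := le_dist_tfPoint (i := i.1) (j := j.1) p2 p1 (fun h => hij (Subtype.ext h))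
    have := le_min h2 h1
    linarith
  · intro w hw
    have h3 := le_norm_tfPoint p2 p1 i.2
    rw [mem_ball_iff_norm'] at hw
    have h4 := norm_sub_norm_le (tfPoint ab.2⁻¹ ab.1⁻¹ i.1) w
    simp only [s, Set.mem_ofPred_eq]
    linarith

theorem MemS0.exists_enorm_le {g : E → ℂ} (hg : MemS0 g) :
    ∃ C : ℝ≥0∞, C ≠ ∞ ∧ ∀ᵐ x, ‖g x‖ₑ ≤ C := by
  obtain ⟨H, hm, hi, hb⟩ := hg.exists_enorm_le_ballInt one_pos
  refine ⟨_, hi, hb.mono fun x hx => hx.trans ?_⟩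
  rw [ballInt_eq]
  exact setLIntegral_le_lintegral _ _

theorem MemS0.exists_tsum_enorm_sub_le {g : E → ℂ} (hg : MemS0 g) {a : ℝ} (ha : 0 < a) :
    ∃ C : ℝ≥0∞, C ≠ ∞ ∧ ∀ᵐ x, ∑' n, ‖g (x - latticePoint a n)‖ₑ ≤ C := by
  obtain ⟨H, hm, hi, hb⟩ := hg.exists_enorm_le_ballInt (half_pos ha)
  refine ⟨_, hi, ?_⟩
  have h : ∀ᵐ x : E, ∀ n : Fin d → ℤ, ‖g (x - latticePoint a n)‖ₑ
      ≤ ballInt (a / 2) H (x - latticePoint a n) := ae_all_iff.2 fun n => ae_comp_sub hb _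
  filter_upwards [h] with x hx
  refine (ENNReal.tsum_le_tsum hx).trans ?_
  rw [← setLIntegral_univ]
  refine tsum_ballInt_le _ H _ (fun i j hij => ?_) fun i => Set.subset_univ _
  rw [dist_sub_left]
  linarith [le_dist_latticePoint ha hij]

theorem MemS0.exists_tsum_enorm_add_le {g : E → ℂ} (hg : MemS0 g) {a : ℝ} (ha : 0 < a) :
    ∃ C : ℝ≥0∞, C ≠ ∞ ∧ ∀ᵐ x, ∑' n, ‖g (x + latticePoint a n)‖ₑ ≤ C := by
  obtain ⟨C, hC, h⟩ := hg.exists_tsum_enorm_sub_le ha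
  refine ⟨C, hC, h.mono fun x hx => le_trans (le_of_eq ?_) hx⟩
  rw [← (Equiv.neg (Fin d → ℤ)).tsum_eq fun n => ‖g (x + latticePoint a n)‖ₑ]
  simp [latticePoint_neg, sub_eq_add_neg]

theorem MemS0.summable_windowedFourier {g γ : E → ℂ} (hg : MemS0 g) (hγ : MemS0 γ) {α β : ℝ}
    (hα : 0 < α) (hβ : 0 < β) : Summable fun i => ‖windowedFourier g γ (tfPoint α β i)‖ :=
  summable_norm_of_tsum_enorm_ne_top ((hg.locallyDominated hγ).tsum_tfPoint_ne_top hα hβ)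

/-- A Gabor series with window `γ` of `h`, evaluated at one time shift, is a periodization. -/
theorem MemS0.tsum_windowedFourier_ae_eq {γ h : E → ℂ} (hγ : MemS0 γ) (hh : MemS0 h) {α β : ℝ}
    (hα : 0 < α) (hβ : 0 < β) :
    ∀ᵐ x, ∀ n, ∑' k, h (x + latticePoint β⁻¹ k) * conj (γ (x + latticePoint β⁻¹ k - latticePoint α n))
      = (β : ℂ) ^ d * ∑' m, windowedFourier γ h (tfPoint α β (n, m)) * chr (latticePoint β m) x := by
  refine ae_all_iff.2 fun n => ?_
  have hK := integrable_mul_conj hh.1 (memLp_translate hγ.1 (latticePoint α n))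
  have hV : ∀ m, windowedFourier γ h (tfPoint α β (n, m))
      = 𝓕 (fun x => h x * conj (γ (x - latticePoint α n))) (latticePoint β m) := fun m =>
    windowedFourier_eq_fourier γ h _ _
  simp only [hV]
  refine tsum_add_latticePoint_ae_eq hK hβ ?_
  simp only [← hV]
  exact ((hγ.summable_windowedFourier hh hα hβ).of_norm).comp_injective (Prod.mk_right_injective n)

/-- The Janssen representation, pointwise almost everywhere, for functions in `S₀`. -/
theorem MemS0.janssen_ae_eq {g γ h : E → ℂ} (hg : MemS0 g) (hγ : MemS0 γ) (hh : MemS0 h) {a b : ℝ}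
    (ha : 0 < a) (hb : 0 < b) :
    ∀ᵐ x, ((a * b : ℝ) : ℂ) ^ d * ∑' i, windowedFourier γ h (tfPoint a b i)
        * timeFreqShift (tfPoint a b i).1 (tfPoint a b i).2 g x
      = ∑' i, windowedFourier γ g (tfPoint b⁻¹ a⁻¹ i)
        * timeFreqShift (tfPoint b⁻¹ a⁻¹ i).1 (tfPoint b⁻¹ a⁻¹ i).2 h x := by
  -- Poisson summation in the frequency index alone. It is applied to `g, h` on the given lattice
  -- and to `h, g` on the adjoint one; the two double sums differ by order of summation and signs of
  -- the indices.
  have key : ∀ {g h : E → ℂ} (_ : MemS0 g) (_ : MemS0 h) {a b : ℝ} (_ : 0 < a) (_ : 0 < b),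
      ∀ᵐ x, (b : ℂ) ^ d * ∑' i, windowedFourier γ h (tfPoint a b i)
        * timeFreqShift (tfPoint a b i).1 (tfPoint a b i).2 g x
        = ∑' n, ∑' k, g (x - latticePoint a n) * (h (x + latticePoint b⁻¹ k) *
          conj (γ (x + latticePoint b⁻¹ k - latticePoint a n))) := by
    intro g h hg hh a b ha hb
    obtain ⟨C, hC, hgC⟩ := hg.exists_enorm_le
    have hgC' : ∀ᵐ x : E, ∀ n : Fin d → ℤ, ‖g (x - latticePoint a n)‖ₑ ≤ C :=
      ae_all_iff.2 fun n => ae_comp_sub hgC _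
    filter_upwards [hγ.tsum_windowedFourier_ae_eq hh ha hb, hgC'] with x hx hxC
    have hsum : Summable fun i => windowedFourier γ h (tfPoint a b i)
        * timeFreqShift (tfPoint a b i).1 (tfPoint a b i).2 g x := by
      refine Summable.of_norm (Summable.of_nonneg_of_le (fun _ => norm_nonneg _) (fun i => ?_)
        ((hγ.summable_windowedFourier hh ha hb).mul_right C.toReal))
      rw [norm_mul, timeFreqShift_apply, norm_mul, norm_chr, one_mul]
      gcongr
      have := ENNReal.toReal_mono hC (hxC i.1)
      rwa [toReal_enorm] at this
    rw [hsum.tsum_prod, ← tsum_mul_left]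
    congr with n
    rw [tsum_mul_left, hx n, ← tsum_mul_left, ← tsum_mul_left, ← tsum_mul_left]
    congr with m
    simp only [tfPoint, timeFreqShift_apply]
    ring
  obtain ⟨Cg, hCg, hgC⟩ := hg.exists_tsum_enorm_sub_le ha
  obtain ⟨Ch, hCh, hhC⟩ := hh.exists_tsum_enorm_add_le (inv_pos.2 hb)
  obtain ⟨Cγ, hCγ, hγC⟩ := hγ.exists_enorm_le
  have hγC' : ∀ᵐ x : E, ∀ n k : Fin d → ℤ,
      ‖γ (x - (latticePoint a n - latticePoint b⁻¹ k))‖ₑ ≤ Cγ :=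
    ae_all_iff.2 fun n => ae_all_iff.2 fun k => ae_comp_sub hγC _
  filter_upwards [key hg hh ha hb, key hh hg (inv_pos.2 hb) (inv_pos.2 ha), hgC, hhC, hγC']
    with x h1 h2 h3 h4 h5
  -- `γ` is bounded, and the translates of `g` and of `h` are each absolutely summable at `x`.
  have hsum : Summable (Function.uncurry fun n k : Fin d → ℤ => g (x - latticePoint a n) *
      (h (x + latticePoint b⁻¹ k) *
        conj (γ (x + latticePoint b⁻¹ k - latticePoint a n)))) := by
    have s1 := summable_norm_of_tsum_enorm_ne_top (ne_top_of_le_ne_top hCg h3)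
    have s2 := summable_norm_of_tsum_enorm_ne_top (ne_top_of_le_ne_top hCh h4)
    have s3 := (s1.mul_of_nonneg s2 (fun _ => norm_nonneg _) (fun _ => norm_nonneg _)).mul_right
      Cγ.toReal
    refine Summable.of_norm (Summable.of_nonneg_of_le (fun _ => norm_nonneg _) (fun i => ?_) s3)
    simp only [Function.uncurry, norm_mul, Complex.norm_conj, mul_assoc]
    gcongr
    have := ENNReal.toReal_mono hCγ (h5 i.1 i.2)
    rw [toReal_enorm] at this
    rwa [show x + latticePoint b⁻¹ i.2 - latticePoint a i.1
      = x - (latticePoint a i.1 - latticePoint b⁻¹ i.2) by abel]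
  have hcomm := hsum.tsum_comm
  rw [inv_inv] at h2
  have e : ∑' n, ∑' k, h (x - latticePoint b⁻¹ n) * (g (x + latticePoint a k) *
          conj (γ (x + latticePoint a k - latticePoint b⁻¹ n)))
      = ∑' k, ∑' n, g (x - latticePoint a n) *
      (h (x + latticePoint b⁻¹ k) *
        conj (γ (x + latticePoint b⁻¹ k - latticePoint a n))) := by
    rw [← (Equiv.neg (Fin d → ℤ)).tsum_eq]
    congr with k
    rw [← (Equiv.neg (Fin d → ℤ)).tsum_eq]
    congr with n
    simp only [Equiv.neg_apply, latticePoint_neg, sub_neg_eq_add, ← sub_eq_add_neg]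
    rw [show x - latticePoint a n + latticePoint b⁻¹ k
      = x + latticePoint b⁻¹ k - latticePoint a n by abel]
    ring
  rw [e, hcomm, ← h1] at h2
  have ha' : (a : ℂ) ≠ 0 := by exact_mod_cast ha.ne'
  push_cast at h2 ⊢
  rw [mul_pow, mul_assoc, ← h2, ← mul_assoc, ← mul_pow, mul_inv_cancel₀ ha', one_pow, one_mul]

end Lattice

/-! ### Pairing $S_0$ with locally integrable functions, and the weak Gabor sum. -/

section Duality

variable {d : ℕ}

local notation "E" => EuclideanSpace ℝ (Fin d)

/-- The supremum of the integrals of `‖f‖` over balls of radius one. -/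
def locNorm (f : E → ℂ) : ℝ≥0∞ := ⨆ z, ballInt 1 (fun x => ‖f x‖ₑ) z

theorem aestronglyMeasurable_translate {f : E → ℂ} (hf : AEStronglyMeasurable f) (t : E) :
    AEStronglyMeasurable (fun x => f (x - t)) :=
  hf.comp_measurePreserving (measurePreserving_sub_right volume t)

theorem aestronglyMeasurable_timeFreqShift {f : E → ℂ} (hf : AEStronglyMeasurable f) (t ω : E) :
    AEStronglyMeasurable (timeFreqShift t ω f) :=
  (continuous_chr_right ω).aestronglyMeasurable.mul (aestronglyMeasurable_translate hf t)

theorem enorm_timeFreqShift (t ω : E) (f : E → ℂ) (x : E) :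
    ‖timeFreqShift t ω f x‖ₑ = ‖f (x - t)‖ₑ := by
  rw [timeFreqShift_apply, enorm_mul, enorm_chr, one_mul]

theorem locNorm_translate_le (f : E → ℂ) (t : E) : locNorm (fun x => f (x - t)) ≤ locNorm f := by
  refine iSup_le fun z => le_trans (le_of_eq ?_) (le_iSup _ (z - t))
  refine lintegral_congr fun y => ?_
  beta_reduce
  rw [show z + y - t = z - t + y by abel]

theorem locNorm_timeFreqShift_le (f : E → ℂ) (t ω : E) :
    locNorm (timeFreqShift t ω f) ≤ locNorm f := by
  refine le_trans (le_of_eq ?_) (locNorm_translate_le f t)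
  simp only [locNorm, enorm_timeFreqShift]

/-- Functions in `S₀` pair with locally uniformly integrable functions. -/
theorem MemS0.exists_lintegral_mul_le {h : E → ℂ} (hh : MemS0 h) :
    ∃ C : ℝ≥0∞, C ≠ ∞ ∧ ∀ f : E → ℂ, AEStronglyMeasurable f →
      ∫⁻ x, ‖f x‖ₑ * ‖h x‖ₑ ≤ C * locNorm f := by
  obtain ⟨H, hm, hi, hb⟩ := hh.exists_enorm_le_ballInt one_pos
  refine ⟨_, hi, fun f hf => ?_⟩
  have hset : MeasurableSet {p : E × E | dist p.2 p.1 < 1} :=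
    measurableSet_lt (measurable_snd.dist measurable_fst) measurable_const
  -- The relation `dist < 1` is symmetric, so Tonelli moves the averaging from `H` onto the norm of
  -- `f`.
  have hball : ∀ (x : E) (F : E → ℝ≥0∞), ballInt 1 F x
      = ∫⁻ w, {p : E × E | dist p.2 p.1 < 1}.indicator (fun p => F p.2) (x, w) := by
    intro x F
    rw [ballInt_eq, ← lintegral_indicator Metric.isOpen_ball.measurableSet]
    rfl
  have hmeas : AEMeasurable (fun p : E × E => ‖f p.1‖ₑ *
      {p : E × E | dist p.2 p.1 < 1}.indicator (fun p => H p.2) p) (volume.prod volume) :=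
    (hf.comp_fst.enorm).mul ((hm.comp measurable_snd).indicator hset).aemeasurable
  calc ∫⁻ x, ‖f x‖ₑ * ‖h x‖ₑ ≤ ∫⁻ x, ‖f x‖ₑ * ballInt 1 H x := by
        refine lintegral_mono_ae ?_
        filter_upwards [hb] with x hx
        gcongr
    _ = ∫⁻ x, ∫⁻ w, ‖f x‖ₑ *
          {p : E × E | dist p.2 p.1 < 1}.indicator (fun p => H p.2) (x, w) := by
        refine lintegral_congr fun x => ?_
        rw [hball, lintegral_const_mul']
        exact enorm_ne_top
    _ = ∫⁻ w, ∫⁻ x, ‖f x‖ₑ *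
          {p : E × E | dist p.2 p.1 < 1}.indicator (fun p => H p.2) (x, w) :=
        lintegral_lintegral_swap hmeas
    _ = ∫⁻ w, H w * ballInt 1 (fun x => ‖f x‖ₑ) w := by
        refine lintegral_congr fun w => ?_
        rw [hball, ← lintegral_const_mul'']
        · refine lintegral_congr fun x => ?_
          by_cases hx : dist w x < 1
          · rw [Set.indicator_of_mem (by exact hx),
              Set.indicator_of_mem (by simpa [dist_comm] using hx), mul_comm]
          · rw [Set.indicator_of_notMem (by exact hx),
              Set.indicator_of_notMem (by simpa [dist_comm] using hx), mul_zero, mul_zero]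
        · refine (hf.enorm).indicator (s := {x | dist x w < 1}) ?_
          exact measurableSet_lt (measurable_id.dist measurable_const) measurable_const
    _ ≤ ∫⁻ w, H w * locNorm f := by
        refine lintegral_mono fun w => ?_
        gcongr
        exact le_iSup (ballInt 1 fun x => ‖f x‖ₑ) w
    _ = (∫⁻ w, H w) * locNorm f := lintegral_mul_const _ hm

theorem MemS0.exists_lintegral_mul_timeFreqShift_le {h : E → ℂ} (hh : MemS0 h) :
    ∃ C : ℝ≥0∞, C ≠ ∞ ∧ ∀ f : E → ℂ, AEStronglyMeasurable f → ∀ z : E × E,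
      ∫⁻ x, ‖f x‖ₑ * ‖timeFreqShift z.1 z.2 h x‖ₑ ≤ C * locNorm f := by
  obtain ⟨C, hC, hb⟩ := hh.exists_lintegral_mul_le
  refine ⟨C, hC, fun f hf z => ?_⟩
  have h1 := hb _ (aestronglyMeasurable_translate hf (-z.1))
  refine le_trans (le_of_eq ?_) (h1.trans (by gcongr; exact locNorm_translate_le f _))
  rw [← lintegral_add_right_eq_self _ z.1]
  simp [enorm_timeFreqShift]

theorem enorm_pairing_le (f g : E → ℂ) : ‖pairing f g‖ₑ ≤ ∫⁻ x, ‖f x‖ₑ * ‖g x‖ₑ := by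
  refine (enorm_integral_le_lintegral_enorm _).trans (le_of_eq ?_)
  simp only [enorm_mul, enorm_conj]

theorem tsum_enorm_mul_ne_top {ι : Type*} {c : ι → ℂ} (hc : Summable fun i => ‖c i‖)
    {B : ι → ℝ≥0∞} {C : ℝ≥0∞} (hC : C ≠ ∞) (hB : ∀ i, B i ≤ C) : ∑' i, ‖c i‖ₑ * B i ≠ ∞ := by
  refine ne_top_of_le_ne_top ?_ (ENNReal.tsum_le_tsum fun i => mul_le_mul_right (hB i) _)
  rw [ENNReal.tsum_mul_right]
  refine ENNReal.mul_ne_top ?_ hC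
  simpa [ofReal_norm] using hc.tsum_ofReal_ne_top

theorem MemS0.summable_mul_pairing {ι : Type*} {c : ι → ℂ}
    (hc : Summable fun i => ‖c i‖) (z : ι → E × E) {f g : E → ℂ} (hf : AEStronglyMeasurable f)
    (hf' : locNorm f ≠ ∞) (hg : MemS0 g) :
    Summable fun i => conj (c i) * pairing f (timeFreqShift (z i).1 (z i).2 g) := by
  obtain ⟨C, hC, hb⟩ := hg.exists_lintegral_mul_timeFreqShift_le
  refine (summable_norm_of_tsum_enorm_ne_top ?_).of_norm
  simp only [enorm_mul, enorm_conj]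
  exact tsum_enorm_mul_ne_top hc (ENNReal.mul_ne_top hC hf')
    fun i => (enorm_pairing_le _ _).trans (hb f hf (z i))

theorem MemS0.pairing_tsum_right {ι : Type*} [Countable ι] {c : ι → ℂ}
    (hc : Summable fun i => ‖c i‖) (z : ι → E × E) {f g : E → ℂ} (hf : AEStronglyMeasurable f)
    (hf' : locNorm f ≠ ∞) (hg : MemS0 g) :
    pairing f (fun x => ∑' i, c i * timeFreqShift (z i).1 (z i).2 g x)
      = ∑' i, conj (c i) * pairing f (timeFreqShift (z i).1 (z i).2 g) := by
  obtain ⟨C, hC, hb⟩ := hg.exists_lintegral_mul_timeFreqShift_le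
  have h1 : ∀ x, f x * conj (∑' i, c i * timeFreqShift (z i).1 (z i).2 g x)
      = ∑' i, conj (c i) * (f x * conj (timeFreqShift (z i).1 (z i).2 g x)) := by
    intro x
    rw [Complex.conj_tsum, ← tsum_mul_left]
    congr with i
    rw [map_mul]; ring
  rw [pairing]
  simp only [h1]
  rw [integral_tsum]
  · simp only [integral_const_mul, pairing]
  · intro i
    exact (hf.mul (Complex.continuous_conj.comp_aestronglyMeasurable
      (aestronglyMeasurable_timeFreqShift hg.1.1 _ _))).const_mul _
  · simp only [enorm_mul, enorm_conj]
    simp only [lintegral_const_mul' _ _ enorm_ne_top]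
    exact tsum_enorm_mul_ne_top hc (ENNReal.mul_ne_top hC hf') fun i => hb f hf (z i)

theorem MemS0.pairing_tsum_left {ι : Type*} [Countable ι] {c : ι → ℂ}
    (hc : Summable fun i => ‖c i‖) (z : ι → E × E) {f h : E → ℂ} (hf : AEStronglyMeasurable f)
    (hf' : locNorm f ≠ ∞) (hh : MemS0 h) :
    pairing (fun x => ∑' i, c i * timeFreqShift (z i).1 (z i).2 f x) h
      = ∑' i, c i * pairing (timeFreqShift (z i).1 (z i).2 f) h := by
  obtain ⟨C, hC, hb⟩ := hh.exists_lintegral_mul_le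
  have h1 : ∀ x, (∑' i, c i * timeFreqShift (z i).1 (z i).2 f x) * conj (h x)
      = ∑' i, c i * (timeFreqShift (z i).1 (z i).2 f x * conj (h x)) := by
    intro x
    rw [← tsum_mul_right]
    congr with i
    ring
  rw [pairing]
  simp only [h1]
  rw [integral_tsum]
  · simp only [integral_const_mul, pairing]
  · intro i
    exact ((aestronglyMeasurable_timeFreqShift hf _ _).mul
      (Complex.continuous_conj.comp_aestronglyMeasurable hh.1.1)).const_mul _
  · simp only [enorm_mul, enorm_conj]
    simp only [lintegral_const_mul' _ _ enorm_ne_top]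
    refine tsum_enorm_mul_ne_top hc (ENNReal.mul_ne_top hC hf') fun i => ?_
    refine (hb _ (aestronglyMeasurable_timeFreqShift hf _ _)).trans ?_
    gcongr
    exact locNorm_timeFreqShift_le f _ _

/-- The phases from the two covariance relations are conjugate and cancel. This matches Janssen's
series for `f` with the adjoint series for `h` under $w\mapsto-w$. -/
theorem windowedFourier_neg_mul_pairing (f g γ h : E → ℂ) (w : E × E) :
    windowedFourier g γ (-w) * pairing (timeFreqShift (-w).1 (-w).2 f) h
      = conj (windowedFourier γ g w) * pairing f (timeFreqShift w.1 w.2 h) := by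
  have h1 := pairing_timeFreqShift_timeFreqShift f h (-w) 0
  have h2 := pairing_timeFreqShift_timeFreqShift g γ (-w) 0
  simp only [Prod.fst_zero, Prod.snd_zero, timeFreqShift_zero, sub_zero, zero_sub, neg_neg] at h1 h2
  rw [h1, windowedFourier, ← pairing_conj_symm, h2, map_mul,
    show windowedFourier h f w = pairing f (timeFreqShift w.1 w.2 h) from rfl]
  linear_combination (conj (windowedFourier γ g w) * pairing f (timeFreqShift w.1 w.2 h)) *
    chr_mul_conj (-w).2 (-w).1

/-- The Janssen form of the Gabor frame operator. -/
def janssenOp (a b : ℝ) (g γ f : E → ℂ) (x : E) : ℂ :=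
  (pairing γ g)⁻¹ * ∑' i, windowedFourier g γ (tfPoint b⁻¹ a⁻¹ i)
    * timeFreqShift (tfPoint b⁻¹ a⁻¹ i).1 (tfPoint b⁻¹ a⁻¹ i).2 f x

/-- The Gabor series is summed by the Janssen representation. -/
theorem isGaborSum_janssenOp {f g γ : E → ℂ} (hg : MemS0 g) (hγ : MemS0 γ)
    (hf : AEStronglyMeasurable f) (hf' : locNorm f ≠ ∞) {a b : ℝ} (ha : 0 < a) (hb : 0 < b) :
    IsGaborSum a b g γ f (janssenOp a b g γ f) := by
  intro h hh
  have hc := hγ.summable_windowedFourier hh ha hb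
  have hc' := hγ.summable_windowedFourier hg (inv_pos.2 hb) (inv_pos.2 ha)
  have hc'' := hg.summable_windowedFourier hγ (inv_pos.2 hb) (inv_pos.2 ha)
  have hs := (MemS0.summable_mul_pairing hc (tfPoint a b) hf hf' hg).hasSum.mul_left
    (((a * b : ℝ) : ℂ) ^ d * (pairing γ g)⁻¹)
  rw [← MemS0.pairing_tsum_right hc (tfPoint a b) hf hf' hg] at hs
  -- The whole operator is moved onto $h\in S_0$, where the Janssen identity holds a.e., and the
  -- adjoint-lattice series is then moved back onto `f`.
  have hval : pairing (janssenOp a b g γ f) h = ((a * b : ℝ) : ℂ) ^ d * (pairing γ g)⁻¹ *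
      pairing f (fun x => ∑' i, windowedFourier γ h (tfPoint a b i)
        * timeFreqShift (tfPoint a b i).1 (tfPoint a b i).2 g x) := by
    have e1 : pairing (janssenOp a b g γ f) h = (pairing γ g)⁻¹ * pairing (fun x =>
        ∑' i, windowedFourier g γ (tfPoint b⁻¹ a⁻¹ i)
        * timeFreqShift (tfPoint b⁻¹ a⁻¹ i).1 (tfPoint b⁻¹ a⁻¹ i).2 f x) h := by
      change ∫ x, janssenOp a b g γ f x * conj (h x) = (pairing γ g)⁻¹ * ∫ x, _
      rw [← integral_const_mul]
      congr with x
      rw [janssenOp, mul_assoc]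
    have e2 : ((a * b : ℝ) : ℂ) ^ d * pairing f (fun x => ∑' i, windowedFourier γ h (tfPoint a b i)
        * timeFreqShift (tfPoint a b i).1 (tfPoint a b i).2 g x)
        = pairing f (fun x => ∑' i, windowedFourier γ g (tfPoint b⁻¹ a⁻¹ i)
        * timeFreqShift (tfPoint b⁻¹ a⁻¹ i).1 (tfPoint b⁻¹ a⁻¹ i).2 h x) := by
      rw [pairing, pairing, ← integral_const_mul]
      refine integral_congr_ae ?_
      filter_upwards [hg.janssen_ae_eq hγ hh ha hb] with x hx
      rw [← hx, map_mul, map_pow, Complex.conj_ofReal]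
      ring
    rw [e1, mul_comm (_ ^ d), mul_assoc, e2, MemS0.pairing_tsum_left hc'' _ hf hf' hh,
      MemS0.pairing_tsum_right hc' _ hf hf' hh, ← (Equiv.neg _).tsum_eq]
    congr 2 with i
    simp only [Equiv.neg_apply, tfPoint_neg]
    exact windowedFourier_neg_mul_pairing f g γ h _
  rw [hval]
  refine hs.congr_fun fun i => ?_
  rw [mul_comm (pairing f _)]
  congr 2
  exact (pairing_conj_symm _ _).symm

end Duality

/-! ### Countable triangle inequalities in $L^p$ and $\ell^q$. -/

/-- The countable triangle inequality for `L^p` seminorms of nonnegative functions. -/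
theorem eLpNorm_tsum_le {α ι : Type*} [MeasurableSpace α] {μ : Measure α} [Countable ι]
    {F : ι → α → ℝ≥0∞} (hF : ∀ i, AEMeasurable (F i) μ) {p : ℝ≥0∞} (hp : 1 ≤ p) :
    eLpNorm (fun x => ∑' i, F i x) p μ ≤ ∑' i, eLpNorm (F i) p μ := by
  by_cases hpt : p = ∞
  · subst hpt
    simp only [eLpNorm_exponent_top]
    refine eLpNormEssSup_le_of_ae_enorm_bound ?_
    have h := ae_all_iff.2 fun i => enorm_ae_le_eLpNormEssSup (F i) μ
    filter_upwards [h] with x hx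
    exact ENNReal.tsum_le_tsum hx
  have hp0 : p ≠ 0 := (one_pos.trans_le hp).ne'
  have hpr : 0 < p.toReal := ENNReal.toReal_pos hp0 hpt
  have hfin : ∀ s : Finset ι, eLpNorm (∑ i ∈ s, F i) p μ ≤ ∑' i, eLpNorm (F i) p μ := fun s =>
    (eLpNorm_sum_le (fun i _ => (hF i).aestronglyMeasurable) hp).trans (ENNReal.sum_le_tsum s)
  rw [eLpNorm_eq_lintegral_rpow_enorm_toReal hp0 hpt, one_div, ENNReal.rpow_inv_le_iff hpr]
  -- A positive power is an order isomorphism of $[0,\infty]$, hence commutes with the supremum of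
  -- finite partial sums; monotone convergence follows.
  have h1 : ∀ x, ‖∑' i, F i x‖ₑ ^ p.toReal = ⨆ s : Finset ι, (∑ i ∈ s, F i x) ^ p.toReal := by
    intro x
    rw [enorm_eq_self, ENNReal.tsum_eq_iSup_sum]
    exact (ENNReal.orderIsoRpow p.toReal hpr).map_iSup _
  simp only [h1]
  rw [lintegral_iSup_directed]
  · refine iSup_le fun s => ?_
    have := hfin s
    rw [eLpNorm_eq_lintegral_rpow_enorm_toReal hp0 hpt, one_div,
      ENNReal.rpow_inv_le_iff hpr] at this
    simpa using this
  · intro s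
    exact (Finset.aemeasurable_fun_sum s fun i _ => hF i).pow_const _
  · refine Monotone.directed_le fun s t hst x => ?_
    beta_reduce
    gcongr

section LittleLp

variable {κ : Type*}

/-- The `ℓ^q` norm of a family of extended nonnegative numbers. -/
def lqNorm (q : ℝ≥0∞) (A : κ → ℝ≥0∞) : ℝ≥0∞ :=
  if q = ∞ then ⨆ k, A k else (∑' k, A k ^ q.toReal) ^ (1 / q.toReal)

theorem lqNorm_eq_eLpNorm [MeasurableSpace κ] [MeasurableSingletonClass κ] {q : ℝ≥0∞}
    (hq : q ≠ 0) (A : κ → ℝ≥0∞) : lqNorm q A = eLpNorm A q Measure.count := by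
  rw [lqNorm]
  split_ifs with h
  · subst h
    simp
  · rw [eLpNorm_eq_lintegral_rpow_enorm_toReal hq h, lintegral_count]
    simp

theorem lqNorm_comp_equiv (q : ℝ≥0∞) (A : κ → ℝ≥0∞) (e : κ ≃ κ) :
    lqNorm q (fun k => A (e k)) = lqNorm q A := by
  rw [lqNorm, lqNorm, e.iSup_comp (g := A), e.tsum_eq (fun k => A k ^ q.toReal)]

theorem lqNorm_mono {q : ℝ≥0∞} {A B : κ → ℝ≥0∞} (h : ∀ k, A k ≤ B k) :
    lqNorm q A ≤ lqNorm q B := by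
  rw [lqNorm, lqNorm]
  split_ifs
  · exact iSup_mono h
  · gcongr with k
    exact h k

theorem le_lqNorm {q : ℝ≥0∞} (hq : q ≠ 0) (A : κ → ℝ≥0∞) (k : κ) : A k ≤ lqNorm q A := by
  rw [lqNorm]
  split_ifs with h
  · exact le_iSup A k
  · have hqr : 0 < q.toReal := ENNReal.toReal_pos hq h
    rw [one_div, ENNReal.le_rpow_inv_iff hqr]
    exact ENNReal.le_tsum (f := fun k => A k ^ q.toReal) k

theorem lqNorm_const_mul {q : ℝ≥0∞} (hq : q ≠ 0) (c : ℝ≥0∞) (A : κ → ℝ≥0∞) :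
    lqNorm q (fun k => c * A k) = c * lqNorm q A := by
  rw [lqNorm, lqNorm]
  split_ifs with h
  · rw [ENNReal.mul_iSup]
  · have hqr : 0 < q.toReal := ENNReal.toReal_pos hq h
    simp only [ENNReal.mul_rpow_of_nonneg _ _ hqr.le]
    rw [ENNReal.tsum_mul_left, ENNReal.mul_rpow_of_nonneg _ _ (by positivity), one_div,
      ENNReal.rpow_rpow_inv hqr.ne']

theorem lqNorm_tsum_le [Countable κ] {ι : Type*} [Countable ι] {q : ℝ≥0∞} (hq : 1 ≤ q)
    (A : ι → κ → ℝ≥0∞) : lqNorm q (fun k => ∑' i, A i k) ≤ ∑' i, lqNorm q (A i) := by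
  let _ : MeasurableSpace κ := ⊤
  have hq0 : q ≠ 0 := (one_pos.trans_le hq).ne'
  simp only [lqNorm_eq_eLpNorm hq0]
  exact eLpNorm_tsum_le (fun i => (measurable_of_countable (A i)).aemeasurable) hq

end LittleLp

/-! ### Estimates for amalgam norms. -/

section Amalgam

variable {d : ℕ}

local notation "E" => EuclideanSpace ℝ (Fin d)

theorem amalgamNorm_eq (p q : ℝ≥0∞) (f : E → ℂ) :
    amalgamNorm p q f = lqNorm q fun k => eLpNorm ((cube k).indicator f) p volume := rfl

theorem measurableSet_cube (k : Fin d → ℤ) : MeasurableSet (cube k) := by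
  have : cube k = ⋂ i, {x : E | (k i : ℝ) ≤ x i ∧ x i < (k i : ℝ) + 1} := by
    ext x; simp [cube]
  rw [this]
  refine MeasurableSet.iInter fun i => ?_
  have hm : Measurable fun x : E => x i := by fun_prop
  exact (measurableSet_le measurable_const hm).inter (measurableSet_lt hm measurable_const)

theorem mem_cube_iff {k : Fin d → ℤ} {x : E} : x ∈ cube k ↔ ∀ i, ⌊x i⌋ = k i :=
  forall_congr' fun i => by rw [Int.floor_eq_iff]

theorem volume_cube (k : Fin d → ℤ) : volume (cube k) = 1 := by
  have h : cube k = WithLp.ofLp ⁻¹' (Set.univ.pi fun i => Set.Ico (k i : ℝ) (k i + 1)) := by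
    ext x; simp [cube, Set.mem_pi]
  rw [h, (PiLp.volume_preserving_ofLp (Fin d)).measure_preimage
    (MeasurableSet.univ_pi fun i => measurableSet_Ico).nullMeasurableSet, Real.volume_pi_Ico]
  simp

/-- The countable triangle inequality for amalgam norms. -/
theorem amalgamNorm_le_tsum {p q : ℝ≥0∞} (hp : 1 ≤ p) (hq : 1 ≤ q) {ι : Type*} [Countable ι]
    {u : E → ℂ} {F : ι → E → ℂ} (hF : ∀ i, AEStronglyMeasurable (F i))
    (hu : ∀ x, ‖u x‖ₑ ≤ ∑' i, ‖F i x‖ₑ) :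
    amalgamNorm p q u ≤ ∑' i, amalgamNorm p q (F i) := by
  simp only [amalgamNorm_eq]
  refine (lqNorm_mono fun k => ?_).trans (lqNorm_tsum_le hq _)
  have h1 : eLpNorm ((cube k).indicator u) p volume
      ≤ eLpNorm (fun x => ∑' i, ‖(cube k).indicator (F i) x‖ₑ) p volume := by
    refine eLpNorm_mono_enorm fun x => ?_
    rw [enorm_eq_self]
    by_cases hx : x ∈ cube k
    · simpa [Set.indicator_of_mem hx] using hu x
    · simp [Set.indicator_of_notMem hx]
  refine h1.trans ((eLpNorm_tsum_le (fun i =>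
    ((hF i).indicator (measurableSet_cube k)).enorm) hp).trans (le_of_eq ?_))
  simp only [eLpNorm_enorm]

theorem amalgamNorm_const_mul {p q : ℝ≥0∞} (hq : q ≠ 0) (c : ℂ) (f : E → ℂ) :
    amalgamNorm p q (fun x => c * f x) = ‖c‖ₑ * amalgamNorm p q f := by
  rw [amalgamNorm_eq, amalgamNorm_eq, ← lqNorm_const_mul hq]
  congr with k
  rw [← eLpNorm_const_smul]
  congr 1
  ext x
  by_cases hx : x ∈ cube k <;> simp [hx]

/-- A translated cube meets at most $2^d$ unit cubes: $\lfloor x_i-t_i\rfloor$ exceeds $\lfloor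
x_i\rfloor+\lfloor-t_i\rfloor$ by 0 or 1. The constant does not depend on the shift. -/
theorem amalgamNorm_timeFreqShift_le {p q : ℝ≥0∞} (hp : 1 ≤ p) (hq : 1 ≤ q) {f : E → ℂ}
    (hf : AEStronglyMeasurable f) (t ω : E) :
    amalgamNorm p q (timeFreqShift t ω f) ≤ Fintype.card (Fin d → Fin 2) * amalgamNorm p q f := by
  let A : (Fin d → ℤ) → ℝ≥0∞ := fun k => eLpNorm ((cube k).indicator f) p volume
  let s : (Fin d → Fin 2) → (Fin d → ℤ) := fun ε i => ⌊-t i⌋ + (ε i : ℕ)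
  have h1 : ∀ k, eLpNorm ((cube k).indicator (timeFreqShift t ω f)) p volume
      ≤ ∑' ε, A (k + s ε) := by
    intro k
    have hG : ∀ ε, AEStronglyMeasurable (fun x => (cube (k + s ε)).indicator f (x - t)) :=
      fun ε => aestronglyMeasurable_translate (hf.indicator (measurableSet_cube _)) t
    calc eLpNorm ((cube k).indicator (timeFreqShift t ω f)) p volume
        ≤ eLpNorm (fun x => ∑' ε, ‖(cube (k + s ε)).indicator f (x - t)‖ₑ) p volume := by
          refine eLpNorm_mono_enorm fun x => ?_
          rw [enorm_eq_self]
          by_cases hx : x ∈ cube k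
          · rw [Set.indicator_of_mem hx, enorm_timeFreqShift]
            have hε : ∀ i, ∃ e : Fin 2, ⌊x i - t i⌋ = k i + (⌊-t i⌋ + ((e : ℕ) : ℤ)) := by
              intro i
              have h2 := mem_cube_iff.1 hx i
              have h3 := Int.le_floor_add (x i) (-t i)
              have h4 := Int.le_floor_add_floor (x i) (-t i)
              rw [← sub_eq_add_neg, h2] at h3 h4
              by_cases h5 : ⌊x i - t i⌋ = k i + ⌊-t i⌋
              · exact ⟨0, by simpa using h5⟩
              · exact ⟨1, by simp; omega⟩
            choose ε hε using hε
            have hm : x - t ∈ cube (k + s ε) := mem_cube_iff.2 hε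
            refine le_trans (le_of_eq ?_) (ENNReal.le_tsum ε)
            rw [Set.indicator_of_mem hm]
          · simp [Set.indicator_of_notMem hx]
      _ ≤ ∑' ε, eLpNorm (fun x => ‖(cube (k + s ε)).indicator f (x - t)‖ₑ) p volume :=
          eLpNorm_tsum_le (fun ε => (hG ε).enorm) hp
      _ = ∑' ε, A (k + s ε) := by
          congr with ε
          rw [eLpNorm_enorm]
          exact eLpNorm_comp_measurePreserving (g := (cube (k + s ε)).indicator f) (hf.indicator (measurableSet_cube _))
            (measurePreserving_sub_right volume t)
  rw [amalgamNorm_eq, amalgamNorm_eq]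
  refine (lqNorm_mono h1).trans ((lqNorm_tsum_le hq _).trans (le_of_eq ?_))
  have h2 : ∀ ε, lqNorm q (fun k => A (k + s ε)) = lqNorm q A := fun ε =>
    lqNorm_comp_equiv q A (Equiv.addRight (s ε))
  simp only [h2, tsum_fintype, Finset.sum_const, nsmul_eq_mul, Finset.card_univ]
  rfl

/-- A unit ball is covered by $3^d$ cubes, and on a cube of measure one the $L^1$ norm is at most
the $L^p$ norm. -/
theorem locNorm_le_amalgamNorm {p q : ℝ≥0∞} (hp : 1 ≤ p) (hq : q ≠ 0) {f : E → ℂ}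
    (hf : AEStronglyMeasurable f) :
    locNorm f ≤ Fintype.card (Fin d → Fin 3) * amalgamNorm p q f := by
  have h1 : ∀ k : Fin d → ℤ, ∫⁻ x in cube k, ‖f x‖ₑ ≤ amalgamNorm p q f := by
    intro k
    rw [← eLpNorm_one_eq_lintegral_enorm, amalgamNorm_eq]
    refine le_trans ?_ (le_lqNorm hq _ k)
    rw [eLpNorm_indicator_eq_eLpNorm_restrict (measurableSet_cube k)]
    have : IsProbabilityMeasure (volume.restrict (cube k)) := ⟨by simp [volume_cube]⟩
    exact eLpNorm_le_eLpNorm_of_exponent_le hp hf.restrict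
  refine iSup_le fun z => ?_
  rw [ballInt_eq]
  let s : (Fin d → Fin 3) → (Fin d → ℤ) := fun ε i => ⌊z i⌋ + (ε i : ℕ) - 1
  have hsub : Metric.ball z 1 ⊆ ⋃ ε, cube (s ε) := by
    intro x hx
    rw [mem_ball_iff_norm] at hx
    have hε : ∀ i, ∃ e : Fin 3, ⌊x i⌋ = ⌊z i⌋ + ((e : ℕ) : ℤ) - 1 := by
      intro i
      have h2 : |x i - z i| < 1 := lt_of_le_of_lt (PiLp.norm_apply_le (x - z) i) hx
      rw [abs_lt] at h2
      have h3 : ⌊z i⌋ - 1 ≤ ⌊x i⌋ := by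
        rw [Int.le_floor]; push_cast; linarith [Int.floor_le (z i)]
      have h4 : ⌊x i⌋ < ⌊z i⌋ + 2 := by
        rw [Int.floor_lt]; push_cast; linarith [Int.lt_floor_add_one (z i)]
      obtain h | h | h : ⌊x i⌋ = ⌊z i⌋ - 1 ∨ ⌊x i⌋ = ⌊z i⌋ ∨ ⌊x i⌋ = ⌊z i⌋ + 1 := by omega
      · exact ⟨0, by simp [h]⟩
      · exact ⟨1, by simp [h]⟩
      · exact ⟨2, by simp [h]; ring⟩
    choose ε hε using hε
    exact Set.mem_iUnion.2 ⟨ε, mem_cube_iff.2 hε⟩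
  calc ∫⁻ x in Metric.ball z 1, ‖f x‖ₑ ≤ ∫⁻ x in ⋃ ε, cube (s ε), ‖f x‖ₑ :=
        lintegral_mono_set hsub
    _ ≤ ∑' ε, ∫⁻ x in cube (s ε), ‖f x‖ₑ := lintegral_iUnion_le _ _
    _ ≤ ∑' _ : Fin d → Fin 3, amalgamNorm p q f := ENNReal.tsum_le_tsum fun ε => h1 _
    _ = _ := by simp only [tsum_fintype, Finset.sum_const, nsmul_eq_mul, Finset.card_univ]

end Amalgam

/-! ### Convergence of Gabor series. -/

section Convergence

variable {d : ℕ}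

local notation "E" => EuclideanSpace ℝ (Fin d)

/-- The terms of the Janssen representation. -/
def janssenTerm (a b : ℝ) (g γ f : E → ℂ) (i : (Fin d → ℤ) × (Fin d → ℤ)) (x : E) : ℂ :=
  ((pairing γ g)⁻¹ * windowedFourier g γ (tfPoint b⁻¹ a⁻¹ i)) *
    timeFreqShift (tfPoint b⁻¹ a⁻¹ i).1 (tfPoint b⁻¹ a⁻¹ i).2 f x

theorem janssenOp_eq_tsum (a b : ℝ) (g γ f : E → ℂ) (x : E) :
    janssenOp a b g γ f x = ∑' i, janssenTerm a b g γ f i x := by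
  simp only [janssenOp, janssenTerm, mul_assoc, tsum_mul_left]

theorem janssenTerm_zero (a b : ℝ) {g γ : E → ℂ} (hne : pairing γ g ≠ 0) (f : E → ℂ) (x : E) :
    janssenTerm a b g γ f 0 x = f x := by
  simp only [janssenTerm, tfPoint_zero, windowedFourier, Prod.fst_zero, Prod.snd_zero,
    timeFreqShift_zero]
  rw [inv_mul_cancel₀ hne, one_mul]

theorem aestronglyMeasurable_janssenTerm (a b : ℝ) (g γ : E → ℂ) {f : E → ℂ}
    (hf : AEStronglyMeasurable f) (i : (Fin d → ℤ) × (Fin d → ℤ)) :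
    AEStronglyMeasurable (janssenTerm a b g γ f i) :=
  (aestronglyMeasurable_timeFreqShift hf _ _).const_mul _

theorem amalgamNorm_janssenTerm_le {p q : ℝ≥0∞} (hp : 1 ≤ p) (hq : 1 ≤ q) (a b : ℝ)
    (g γ : E → ℂ) {f : E → ℂ} (hf : AEStronglyMeasurable f) (i : (Fin d → ℤ) × (Fin d → ℤ)) :
    amalgamNorm p q (janssenTerm a b g γ f i)
      ≤ ‖(pairing γ g)⁻¹‖ₑ * (Fintype.card (Fin d → Fin 2) * amalgamNorm p q f) *
        ‖windowedFourier g γ (tfPoint b⁻¹ a⁻¹ i)‖ₑ := by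
  unfold janssenTerm
  rw [amalgamNorm_const_mul (one_pos.trans_le hq).ne', enorm_mul, mul_right_comm]
  gcongr
  exact amalgamNorm_timeFreqShift_le hp hq hf _ _

/-- If the remaining terms are not absolutely summable the right side is $\infty$, so the default
value of `tsum` does no harm and the bound holds at every point. -/
theorem enorm_tsum_sub_le {ι : Type*} (u : ι → ℂ) (i₀ : ι) :
    ‖∑' i, u i - u i₀‖ₑ ≤ ∑' i : {i : ι // i ≠ i₀}, ‖u i‖ₑ := by
  classical
  by_cases htop : ∑' i : {i : ι // i ≠ i₀}, ‖u i‖ₑ = ∞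
  · rw [htop]; exact le_top
  have hs : Summable fun i : {i : ι // i ≠ i₀} => u i :=
    (summable_norm_of_tsum_enorm_ne_top htop).of_norm
  have h1 : HasSum (Set.indicator {i | i ≠ i₀} u) (∑' i : {i : ι // i ≠ i₀}, u i) :=
    hasSum_subtype_iff_indicator.1 hs.hasSum
  have h2 : HasSum u (u i₀ + ∑' i : {i : ι // i ≠ i₀}, u i) := by
    convert (hasSum_ite_eq i₀ (u i₀)).add h1 using 2 with i
    by_cases h : i = i₀
    · simp [h]
    · simp [h]
  rw [h2.tsum_eq, add_sub_cancel_left]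
  exact enorm_tsum_le_tsum_enorm

theorem enorm_janssenOp_sub_le (a b : ℝ) {g γ : E → ℂ} (hne : pairing γ g ≠ 0) (f : E → ℂ)
    (x : E) : ‖(janssenOp a b g γ f - f) x‖ₑ
      ≤ ∑' i : {i : (Fin d → ℤ) × (Fin d → ℤ) // i ≠ 0}, ‖janssenTerm a b g γ f i x‖ₑ := by
  have h := enorm_tsum_sub_le (fun i => janssenTerm a b g γ f i x) 0
  rwa [← janssenOp_eq_tsum, janssenTerm_zero a b hne] at h

/-- Gabor series with windows in `S₀` converge on Wiener amalgam spaces. -/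
theorem gaborConverges {p q : ℝ≥0∞} (hp : 1 ≤ p) (hq : 1 ≤ q) {g γ : E → ℂ} (hg : MemS0 g)
    (hγ : MemS0 γ) (hne : pairing γ g ≠ 0) : GaborConverges p q g γ := by
  intro f hf
  have hq0 : q ≠ 0 := (one_pos.trans_le hq).ne'
  have hloc : locNorm f ≠ ∞ := ne_top_of_le_ne_top
    (ENNReal.mul_ne_top (ENNReal.natCast_ne_top _) hf.2.ne) (locNorm_le_amalgamNorm hp hq0 hf.1)
  have hdom := hg.locallyDominated hγ
  have hK : ‖(pairing γ g)⁻¹‖ₑ * (Fintype.card (Fin d → Fin 2) * amalgamNorm p q f) ≠ ∞ :=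
    ENNReal.mul_ne_top enorm_ne_top (ENNReal.mul_ne_top (ENNReal.natCast_ne_top _) hf.2.ne)
  refine ⟨fun a b => janssenOp a b g γ f, fun a b ha hb => ⟨⟨?_, ?_⟩, ?_⟩, ?_⟩
  · simp only [funext (janssenOp_eq_tsum a b g γ f)]
    exact AEStronglyMeasurable.tsum fun i => aestronglyMeasurable_janssenTerm a b g γ hf.1 i
  · refine lt_of_le_of_lt (amalgamNorm_le_tsum hp hq
      (fun i => aestronglyMeasurable_janssenTerm a b g γ hf.1 i) fun x => ?_) ?_
    · beta_reduce
      rw [janssenOp_eq_tsum]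
      exact enorm_tsum_le_tsum_enorm
    · refine lt_of_le_of_lt (ENNReal.tsum_le_tsum fun i =>
        amalgamNorm_janssenTerm_le hp hq a b g γ hf.1 i) ?_
      rw [ENNReal.tsum_mul_left]
      exact (ENNReal.mul_ne_top hK
        (hdom.tsum_tfPoint_ne_top (inv_pos.2 hb) (inv_pos.2 ha))).lt_top
  · exact isGaborSum_janssenOp hg hγ hf.1 hloc ha hb
  · have hlim := ENNReal.Tendsto.const_mul hdom.tendsto_tsum_tfPoint (Or.inr hK)
    rw [mul_zero] at hlim
    refine tendsto_of_tendsto_of_tendsto_of_le_of_le tendsto_const_nhds hlim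
      (fun _ => zero_le) fun ab => ?_
    refine (amalgamNorm_le_tsum hp hq
      (fun i : {i : (Fin d → ℤ) × (Fin d → ℤ) // i ≠ 0} =>
        aestronglyMeasurable_janssenTerm ab.1 ab.2 g γ hf.1 i.1)
      (enorm_janssenOp_sub_le ab.1 ab.2 hne f)).trans ?_
    rw [← ENNReal.tsum_mul_left]
    exact ENNReal.tsum_le_tsum fun i =>
      amalgamNorm_janssenTerm_le hp hq ab.1 ab.2 g γ hf.1 i.1

/-- Windowed Fourier transforms in `S₀` vanish along dilated nonzero lattice points. -/
theorem tendsto_windowedFourier_tfPoint {g γ : E → ℂ} (hg : MemS0 g) (hγ : MemS0 γ)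
    {i : (Fin d → ℤ) × (Fin d → ℤ)} (hi : i ≠ 0) :
    Tendsto (fun ab : ℝ × ℝ => windowedFourier g γ (tfPoint ab.2⁻¹ ab.1⁻¹ i))
      (𝓝[>] (0 : ℝ) ×ˢ 𝓝[>] (0 : ℝ)) (𝓝 0) := by
  have h := tendsto_of_tendsto_of_tendsto_of_le_of_le tendsto_const_nhds
    (hg.locallyDominated hγ).tendsto_tsum_tfPoint (fun _ => zero_le)
    (f := fun ab : ℝ × ℝ => ‖windowedFourier g γ (tfPoint ab.2⁻¹ ab.1⁻¹ i)‖ₑ)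
    fun ab => ENNReal.le_tsum
      (f := fun j : {i : (Fin d → ℤ) × (Fin d → ℤ) // i ≠ 0} =>
        ‖windowedFourier g γ (tfPoint ab.2⁻¹ ab.1⁻¹ j)‖ₑ) ⟨i, hi⟩
  rw [tendsto_zero_iff_norm_tendsto_zero]
  have h2 := (ENNReal.tendsto_toReal ENNReal.zero_ne_top).comp h
  simpa [Function.comp_def] using h2

end Convergence

end GaborAmalgam

end

theorem mainTheorem4 (d : ℕ) (hd : 1 ≤ d) (g γ : EuclideanSpace ℝ (Fin d) → ℂ)
    (hg : GaborAmalgam.MemS0 g) (hγ : GaborAmalgam.MemS0 γ)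
    (hne : GaborAmalgam.pairing γ g ≠ 0)
    (p q : ℝ≥0∞) (hp : 1 ≤ p) (hp_top : p ≠ ∞) (hq : 1 ≤ q) :
    (GaborAmalgam.GaborConverges p q g γ ∧ GaborAmalgam.GaborConverges p q γ g) ↔
      ∀ l n : Fin d → ℤ,
        Tendsto (fun ab : ℝ × ℝ =>
            (GaborAmalgam.pairing γ g)⁻¹ *
              GaborAmalgam.pairing γ
                (GaborAmalgam.modulate (GaborAmalgam.latticePoint ab.1⁻¹ l)
                  (GaborAmalgam.translate (GaborAmalgam.latticePoint ab.2⁻¹ n) g)))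
          (𝓝[>] (0 : ℝ) ×ˢ 𝓝[>] (0 : ℝ))
          (𝓝 ((if l = 0 then 1 else 0) * (if n = 0 then 1 else 0))) := by
  have hne' : GaborAmalgam.pairing g γ ≠ 0 := by
    rw [← GaborAmalgam.pairing_conj_symm]
    simpa using hne
  refine iff_of_true ⟨GaborAmalgam.gaborConverges hp hq hg hγ hne,
    GaborAmalgam.gaborConverges hp hq hγ hg hne'⟩ fun l n => ?_
  -- `tfPoint` lists the time shift $n/b$ first, hence the index $(n,l)$.
  by_cases h : (n, l) = (0 : (Fin d → ℤ) × (Fin d → ℤ))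
  · obtain ⟨rfl, rfl⟩ := Prod.mk_eq_zero.1 h
    refine tendsto_const_nhds.congr fun ab => ?_
    have h0 : GaborAmalgam.modulate (GaborAmalgam.latticePoint ab.1⁻¹ 0)
        (GaborAmalgam.translate (GaborAmalgam.latticePoint ab.2⁻¹ 0) g) = g := by
      rw [GaborAmalgam.latticePoint_zero, GaborAmalgam.latticePoint_zero]
      exact GaborAmalgam.timeFreqShift_zero g
    rw [h0, inv_mul_cancel₀ hne]
    simp
  · have hlim := (GaborAmalgam.tendsto_windowedFourier_tfPoint hg hγ h).const_mul
      (GaborAmalgam.pairing γ g)⁻¹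
    rw [mul_zero] at hlim
    have hz : ((if l = 0 then 1 else 0) * (if n = 0 then 1 else 0) : ℂ) = 0 := by
      by_cases hl : l = 0
      · have hn : n ≠ 0 := fun hn => h (by rw [hl, hn]; rfl)
        simp [hn]
      · simp [hl]
    rw [hz]
    exact hlim
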